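/- Let $g,\varphi_0>0$, $0<\theta<\pi/2$, let $\alpha_2,\beta_2<0$, and let $\alpha_1,\beta_1\in\mathbb R$ satisfy $$\alpha_1+\beta_1>0,\qquad |\alpha_2|+|\beta_2|>\frac{\alpha_1+\beta_1}{\tan^2\theta},\qquad \min\{|\alpha_2|,|\beta_2|\}+\frac{\alpha_1+\beta_1}{\tan^2\theta}>|\alpha_2|+|\beta_2|.$$ Then there are functions $w,\varphi,P,Z:\mathbb R\to\mathbb R$ with $w,\varphi>0$ that solve on all of $\mathbb R$ the Ambjørn–Olesen electroweak domain wall equations $$w'=-g(\sin\theta\,P+\cos\theta\,Z)w,\qquad \varphi'=\frac{g}{2\cos\theta}Z\varphi,$$ $$P'=\frac{g}{2\sin\theta}\varphi_0^2+2g\sin\theta\,w^2,\qquad Z'=\frac{g}{2\cos\theta}(\varphi^2-\varphi_0^2)+2g\cos\theta\,w^2,$$ and the second-order system $$(\ln w)''=-\frac{g^2}{2}\varphi^2-2g^2w^2,\qquad (\ln\varphi)''=\frac{g^2}{4\cos^2\theta}(\varphi^2-\varphi_0^2)+g^2w^2,$$ such that $w(x),\varphi(x)\to0$ as $x\to\pm\infty$,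 and such that the following hold. (i) One has the sharp decay behavior $$w^2(x)=O\left(e^{-|\alpha_2|x}\right)\quad(x\to\infty),\qquad w^2(x)=O\left(e^{|\beta_2|x}\right)\quad(x\to-\infty),$$ $$\varphi^2(x)=O\left(\exp\left\{-\frac{g^2\varphi_0^2}{4\cos^2\theta}x^2+\frac12(\alpha_1+|\alpha_2|)x\right\}\right)\quad(x\to\infty),$$ $$\varphi^2(x)=O\left(\exp\left\{-\frac{g^2\varphi_0^2}{4\cos^2\theta}x^2-\frac12(\beta_1+|\beta_2|)x\right\}\right)\quad(x\to-\infty),$$ where sharp means that each function on the left is also bounded below, near the respective infinity, by a positive constant times the function inside $O(\cdot)$. (ii) The functions $w^2$ and $\varphi^2$ are integrable over $\mathbb R$, and $$\int_{\mathbb R} w^2\,dx=\frac1{4g^2}\left(|\alpha_2|+|\beta_2|-\frac{\alpha_1+\beta_1}{\tan^2\theta}\right),\qquad \int_{\mathbb R}\varphi^2\,dx=\frac{\alpha_1+\beta_1}{g^2\tan^2\theta}.$$ -/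

import Mathlib

open Filter Topology MeasureTheory Asymptotics

/-- The first-order (BPS) electroweak domain wall equations for real functions
`w, φ, P, Z` on the line, everywhere in the classical sense. -/
structure IsElectroweakWall (g φ₀ θ : ℝ) (w φ P Z : ℝ → ℝ) : Prop where
  w_eq : ∀ x, HasDerivAt w (-g * (Real.sin θ * P x + Real.cos θ * Z x) * w x) x
  φ_eq : ∀ x, HasDerivAt φ (g / (2 * Real.cos θ) * Z x * φ x) x
  P_eq : ∀ x, HasDerivAt P
    (g / (2 * Real.sin θ) * φ₀ ^ 2 + 2 * g * Real.sin θ * w x ^ 2) x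
  Z_eq : ∀ x, HasDerivAt Z
    (g / (2 * Real.cos θ) * (φ x ^ 2 - φ₀ ^ 2) + 2 * g * Real.cos θ * w x ^ 2) x

/-- The second-order domain wall equations for positive `w, φ`:
`(ln w)'' = -(g²/2) φ² - 2 g² w²` and
`(ln φ)'' = (g²/(4 cos² θ)) (φ² - φ₀²) + g² w²`, in the classical sense. -/
structure IsSecondOrderWall (g φ₀ θ : ℝ) (w φ : ℝ → ℝ) : Prop where
  w_pos : ∀ x, 0 < w x
  φ_pos : ∀ x, 0 < φ x
  w_diff : Differentiable ℝ (fun y => Real.log (w y))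
  φ_diff : Differentiable ℝ (fun y => Real.log (φ y))
  w_eq : ∀ x, HasDerivAt (deriv fun y => Real.log (w y))
    (-(g ^ 2 / 2) * φ x ^ 2 - 2 * g ^ 2 * w x ^ 2) x
  φ_eq : ∀ x, HasDerivAt (deriv fun y => Real.log (φ y))
    (g ^ 2 / (4 * Real.cos θ ^ 2) * (φ x ^ 2 - φ₀ ^ 2) + g ^ 2 * w x ^ 2) x

/-! Set m = (α₁+β₁)/tan²θ and n = |α₂|+|β₂|-m, the prescribed masses of g²φ² and 4g²w². Write 4g²w²
= n p and g²φ² = m q with probability densities p, q whose distribution functions are P, Q (not the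
gauge field P). Integrating the second-order system once makes ln w² and ln φ², up to constants,
explicit functions `potU P Q` and `potV P Q`, affine in the pair (P, Q). Since p and q are the
normalised exponentials of these potentials, the problem becomes a fixed point equation P =
`gibbsCdf (potU P Q)`, Q = `gibbsCdf (potV P Q)`. The masses are then built in, and the decay is
read off from the potentials.

The fixed point is found variationally. The Gibbs map preserves a convex class of Lipschitz
functions exponentially close to the Heaviside step H (`isConfining_potV`, `isConfining_potU`),
which is compact by Arzelà–Ascoli. With c = tan²θ, the functional ½∫(m(Q-H)+n(P-H))² + ½cm²∫(Q-H)² +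
2m log∫exp(potV) - n log∫exp(potU) is continuous there and has a minimiser (`exists_energy_min`).
Its derivative towards the Gibbs image (P', Q') is minus the positive definite form
∫(m(Q'-Q)+n(P'-P))² + cm²∫(Q'-Q)² (`exists_energy_convex_comb_le`). The segment to the image stays
in the class, so at a minimiser this form vanishes and the pair is fixed. No convexity of the energy
is needed. -/

/-- The Heaviside step. -/
noncomputable def unitStep (x : ℝ) : ℝ := if 0 < x then 1 else 0

theorem unitStep_of_pos {x : ℝ} (hx : 0 < x) : unitStep x = 1 := if_pos hx

theorem unitStep_of_nonpos {x : ℝ} (hx : x ≤ 0) : unitStep x = 0 := if_neg hx.not_gt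

theorem measurable_unitStep : Measurable unitStep :=
  Measurable.ite measurableSet_Ioi measurable_const measurable_const

theorem integrable_exp_neg_mul_abs {δ : ℝ} (hδ : 0 < δ) :
    Integrable fun x : ℝ => Real.exp (-δ * |x|) := by
  rw [← integrableOn_univ, ← Set.Iic_union_Ioi (a := (0 : ℝ))]
  refine IntegrableOn.union ?_ ?_
  · refine (integrableOn_exp_mul_Iic hδ 0).congr_fun (fun x hx => ?_) measurableSet_Iic
    simp [abs_of_nonpos (Set.mem_Iic.1 hx)]
  · refine (integrableOn_exp_mul_Ioi (neg_lt_zero.2 hδ) 0).congr_fun (fun x hx => ?_)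
      measurableSet_Ioi
    simp [abs_of_pos (Set.mem_Ioi.1 hx)]

theorem integrable_of_abs_le_exp {f : ℝ → ℝ} {C δ : ℝ} (hδ : 0 < δ)
    (hf : AEStronglyMeasurable f) (h : ∀ x, |f x| ≤ C * Real.exp (-δ * |x|)) : Integrable f :=
  ((integrable_exp_neg_mul_abs hδ).const_mul C).mono' hf (ae_of_all _ h)

/-! ### Step-like functions: a convex compact class -/

/-- Lipschitz functions with values in `[0, 1]` that approach the Heaviside step exponentially
fast. -/
structure IsStepLike (C δ L : ℝ) (f : ℝ → ℝ) : Prop where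
  nonneg : ∀ x, 0 ≤ f x
  le_one : ∀ x, f x ≤ 1
  lip : ∀ x y, |f x - f y| ≤ L * |x - y|
  tail : ∀ x, |f x - unitStep x| ≤ C * Real.exp (-δ * |x|)

namespace IsStepLike

variable {C δ L : ℝ} {f h : ℝ → ℝ}

theorem lipschitzWith (hf : IsStepLike C δ L f) : LipschitzWith L.toNNReal f := by
  refine LipschitzWith.of_dist_le_mul fun x y => ?_
  rw [Real.dist_eq, Real.dist_eq]
  exact (hf.lip x y).trans (by gcongr; exact Real.le_coe_toNNReal L)

theorem continuous (hf : IsStepLike C δ L f) : Continuous f := hf.lipschitzWith.continuous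

theorem coeff_nonneg (hf : IsStepLike C δ L f) : 0 ≤ C := by
  have := (abs_nonneg _).trans (hf.tail 0)
  simpa using this

theorem convex_comb (hf : IsStepLike C δ L f) (hh : IsStepLike C δ L h) {ε : ℝ} (h0 : 0 ≤ ε)
    (h1 : ε ≤ 1) : IsStepLike C δ L fun x => f x + ε * (h x - f x) := by
  have key : ∀ a b B : ℝ, |a| ≤ B → |b| ≤ B → |(1 - ε) * a + ε * b| ≤ B := by
    intro a b B ha hb
    rw [abs_le] at *
    constructor <;> nlinarith
  refine ⟨fun x => ?_, fun x => ?_, fun x y => ?_, fun x => ?_⟩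
  · nlinarith [hf.nonneg x, hh.nonneg x]
  · nlinarith [hf.le_one x, hh.le_one x]
  · convert key _ _ _ (hf.lip x y) (hh.lip x y) using 2; ring
  · convert key _ _ _ (hf.tail x) (hh.tail x) using 2; ring

theorem abs_sub_le (hf : IsStepLike C δ L f) {C' L' : ℝ} (hh : IsStepLike C' δ L' h) (x : ℝ) :
    |h x - f x| ≤ (C' + C) * Real.exp (-δ * |x|) := by
  have h1 := hh.tail x
  have h2 := hf.tail x
  rw [abs_le] at *
  constructor <;> linarith

end IsStepLike

/-- Arzelà–Ascoli: the common Lipschitz constant gives equicontinuity. All defining conditions are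
pointwise and closed, so the class is closed in the product topology, inside a product of copies of
[0, 1]. -/
theorem isCompact_setOf_isStepLike (C δ L : ℝ) :
    IsCompact {f : C(ℝ, ℝ) | IsStepLike C δ L f} := by
  refine ArzelaAscoli.isCompact_of_equicontinuous _ ?_ ?_
  · have himg : ContinuousMap.toFun '' {f : C(ℝ, ℝ) | IsStepLike C δ L f}
        = {f : ℝ → ℝ | IsStepLike C δ L f} := by
      ext f
      constructor
      · rintro ⟨F, hF, rfl⟩
        exact hF
      · intro hf
        exact ⟨⟨f, hf.continuous⟩, hf, rfl⟩
    rw [himg]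
    refine (isCompact_univ_pi fun _ : ℝ => isCompact_Icc (a := (0 : ℝ)) (b := 1)).of_isClosed_subset
      ?_ (fun f hf x _ => ⟨hf.nonneg x, hf.le_one x⟩)
    have hset : {f : ℝ → ℝ | IsStepLike C δ L f}
        = {f | ∀ x, 0 ≤ f x} ∩ {f | ∀ x, f x ≤ 1} ∩ {f | ∀ x y, |f x - f y| ≤ L * |x - y|}
          ∩ {f | ∀ x, |f x - unitStep x| ≤ C * Real.exp (-δ * |x|)} := by
      ext f
      exact ⟨fun h => ⟨⟨⟨h.nonneg, h.le_one⟩, h.lip⟩, h.tail⟩,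
        fun h => ⟨h.1.1.1, h.1.1.2, h.1.2, h.2⟩⟩
    rw [hset]
    refine IsClosed.inter (IsClosed.inter (IsClosed.inter ?_ ?_) ?_) ?_ <;>
      simp only [Set.ofPred_forall]
    · exact isClosed_iInter fun x => isClosed_le continuous_const (continuous_apply x)
    · exact isClosed_iInter fun x => isClosed_le (continuous_apply x) continuous_const
    · exact isClosed_iInter fun x => isClosed_iInter fun y => isClosed_le
        ((continuous_apply x).sub (continuous_apply y)).abs continuous_const
    · exact isClosed_iInter fun x => isClosed_le
        ((continuous_apply x).sub continuous_const).abs continuous_const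
  · exact (LipschitzWith.uniformEquicontinuous _ L.toNNReal
      fun f => f.2.lipschitzWith).equicontinuous

/-! ### Gibbs distribution functions of confining potentials -/

/-- The distribution function of the probability density proportional to `exp f`. -/
noncomputable def gibbsCdf (f : ℝ → ℝ) (x : ℝ) : ℝ :=
  (∫ y in Set.Iic x, Real.exp (f y)) / ∫ y, Real.exp (f y)

/-- A continuous potential below a tent `K - δ |x|` and above `-A` on the unit interval. -/
structure IsConfining (K δ A : ℝ) (f : ℝ → ℝ) : Prop where
  continuous : Continuous f
  le_tent : ∀ x, f x ≤ K - δ * |x|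
  ge_on : ∀ x ∈ Set.Icc (0 : ℝ) 1, -A ≤ f x

namespace IsConfining

variable {K δ A : ℝ} {f : ℝ → ℝ}

theorem exp_le (hf : IsConfining K δ A f) (x : ℝ) :
    Real.exp (f x) ≤ Real.exp K * Real.exp (-δ * |x|) := by
  rw [← Real.exp_add]
  exact Real.exp_le_exp.2 (by linarith [hf.le_tent x])

theorem integrable_exp (hf : IsConfining K δ A f) (hδ : 0 < δ) :
    Integrable fun x => Real.exp (f x) :=
  integrable_of_abs_le_exp hδ hf.continuous.rexp.aestronglyMeasurable
    fun x => by rw [abs_of_pos (Real.exp_pos _)]; exact hf.exp_le x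

theorem exp_neg_le_integral (hf : IsConfining K δ A f) (hδ : 0 < δ) :
    Real.exp (-A) ≤ ∫ x, Real.exp (f x) := by
  calc Real.exp (-A) = ∫ _ in Set.Icc (0 : ℝ) 1, Real.exp (-A) := by simp
    _ ≤ ∫ x in Set.Icc (0 : ℝ) 1, Real.exp (f x) := by
      refine setIntegral_mono_on ?_ (hf.integrable_exp hδ).integrableOn measurableSet_Icc
        fun x hx => Real.exp_le_exp.2 (hf.ge_on x hx)
      exact integrableOn_const (by simp)
    _ ≤ ∫ x, Real.exp (f x) :=
      setIntegral_le_integral (hf.integrable_exp hδ) (ae_of_all _ fun x => (Real.exp_pos _).le)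

theorem integral_pos (hf : IsConfining K δ A f) (hδ : 0 < δ) : 0 < ∫ x, Real.exp (f x) :=
  (Real.exp_pos _).trans_le (hf.exp_neg_le_integral hδ)

theorem density_le (hf : IsConfining K δ A f) (hδ : 0 < δ) (x : ℝ) :
    Real.exp (f x) / ∫ y, Real.exp (f y) ≤ Real.exp (K + A) * Real.exp (-δ * |x|) := by
  rw [div_le_iff₀ (hf.integral_pos hδ)]
  calc Real.exp (f x) ≤ Real.exp (K + A) * Real.exp (-δ * |x|) * Real.exp (-A) := by
        rw [← Real.exp_add, ← Real.exp_add]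
        exact Real.exp_le_exp.2 (by linarith [hf.le_tent x])
    _ ≤ _ := by gcongr; exact hf.exp_neg_le_integral hδ

theorem hasDerivAt_gibbsCdf (hf : IsConfining K δ A f) (hδ : 0 < δ) (x : ℝ) :
    HasDerivAt (gibbsCdf f) (Real.exp (f x) / ∫ y, Real.exp (f y)) x := by
  have hint := hf.integrable_exp hδ
  have h : ∀ y, gibbsCdf f y = ((∫ z in Set.Iic (0 : ℝ), Real.exp (f z)) +
      ∫ z in (0 : ℝ)..y, Real.exp (f z)) / ∫ z, Real.exp (f z) := by
    intro y
    rw [gibbsCdf, ← intervalIntegral.integral_Iic_sub_Iic hint.integrableOn hint.integrableOn]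
    ring
  rw [funext h]
  exact ((intervalIntegral.integral_hasDerivAt_right hint.intervalIntegrable
    (hf.continuous.rexp.stronglyMeasurableAtFilter _ _)
    hf.continuous.rexp.continuousAt).const_add _).div_const _

theorem one_sub_gibbsCdf (hf : IsConfining K δ A f) (hδ : 0 < δ) (x : ℝ) :
    1 - gibbsCdf f x = ∫ y in Set.Ioi x, Real.exp (f y) / ∫ y, Real.exp (f y) := by
  have hint := hf.integrable_exp hδ
  have h := intervalIntegral.integral_Iic_add_Ioi (b := x) hint.integrableOn hint.integrableOn
  rw [gibbsCdf, integral_div, ← h, h, eq_div_iff (hf.integral_pos hδ).ne', sub_mul,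
    div_mul_cancel₀ _ (hf.integral_pos hδ).ne', one_mul, ← h]
  ring

/-- The tent bound and the lower bound on the partition function dominate the density by exp(K+A)
exp(-δ|x|). Its supremum is the Lipschitz constant, and integrating it over a half-line gives the
tail constant. -/
theorem isStepLike_gibbsCdf (hf : IsConfining K δ A f) (hδ : 0 < δ) :
    IsStepLike (Real.exp (K + A) / δ) δ (Real.exp (K + A)) (gibbsCdf f) := by
  have hint := (hf.integrable_exp hδ).div_const (∫ y, Real.exp (f y))
  have hnn : ∀ x, 0 ≤ Real.exp (f x) / ∫ y, Real.exp (f y) := fun x =>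
    div_nonneg (Real.exp_pos _).le (hf.integral_pos hδ).le
  have h0 : ∀ x, 0 ≤ gibbsCdf f x := fun x =>
    div_nonneg (integral_nonneg fun _ => (Real.exp_pos _).le) (hf.integral_pos hδ).le
  have h1 : ∀ x, gibbsCdf f x ≤ 1 := fun x => by
    rw [← sub_nonneg, hf.one_sub_gibbsCdf hδ]
    exact integral_nonneg fun y => hnn y
  refine ⟨h0, h1, fun x y => ?_, fun x => ?_⟩
  · have := Convex.norm_image_sub_le_of_norm_hasDerivWithin_le (s := Set.univ)
      (fun z _ => (hf.hasDerivAt_gibbsCdf hδ z).hasDerivWithinAt) (C := Real.exp (K + A))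
      (fun z _ => ?_) convex_univ (Set.mem_univ y) (Set.mem_univ x)
    · simpa [Real.norm_eq_abs] using this
    · rw [Real.norm_eq_abs, abs_of_nonneg (hnn z)]
      refine (hf.density_le hδ z).trans (mul_le_of_le_one_right (Real.exp_pos _).le ?_)
      exact Real.exp_le_one_iff.2 (by nlinarith [abs_nonneg z])
  · rcases le_or_gt x 0 with hx | hx
    · rw [unitStep_of_nonpos hx, sub_zero, abs_of_nonneg (h0 x), gibbsCdf, ← integral_div,
        abs_of_nonpos hx]
      calc ∫ y in Set.Iic x, Real.exp (f y) / ∫ y, Real.exp (f y)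
          ≤ ∫ y in Set.Iic x, Real.exp (K + A) * Real.exp (δ * y) := by
            refine setIntegral_mono_on hint.integrableOn
              ((integrableOn_exp_mul_Iic hδ x).const_mul _) measurableSet_Iic fun y hy => ?_
            have := hf.density_le hδ y
            rwa [abs_of_nonpos (le_trans hy hx), neg_mul_neg] at this
        _ = _ := by
            rw [integral_const_mul, integral_exp_mul_Iic hδ, neg_mul_neg]
            ring
    · rw [unitStep_of_pos hx, abs_sub_comm, abs_of_nonneg (sub_nonneg.2 (h1 x)),
        hf.one_sub_gibbsCdf hδ, abs_of_pos hx]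
      calc ∫ y in Set.Ioi x, Real.exp (f y) / ∫ y, Real.exp (f y)
          ≤ ∫ y in Set.Ioi x, Real.exp (K + A) * Real.exp (-δ * y) := by
            refine setIntegral_mono_on hint.integrableOn
              ((integrableOn_exp_mul_Ioi (neg_lt_zero.2 hδ) x).const_mul _) measurableSet_Ioi
              fun y hy => ?_
            have := hf.density_le hδ y
            rwa [abs_of_pos (hx.trans hy)] at this
        _ = _ := by
            rw [integral_const_mul, integral_exp_mul_Ioi (neg_lt_zero.2 hδ)]
            field_simp

end IsConfining

/-! ### Integration by parts against a distribution function -/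

theorem integral_exp_neg_mul_abs_le {δ : ℝ} (hδ : 0 < δ) (x : ℝ) :
    |∫ y in (0 : ℝ)..x, Real.exp (-δ * |y|)| ≤ 1 / δ := by
  have hint := integrable_exp_neg_mul_abs hδ
  rcases le_or_gt 0 x with hx | hx
  · rw [intervalIntegral.integral_of_le hx,
      abs_of_nonneg (integral_nonneg fun _ => (Real.exp_pos _).le)]
    calc _ ≤ ∫ y in Set.Ioi (0 : ℝ), Real.exp (-δ * |y|) :=
          setIntegral_mono_set hint.integrableOn (ae_of_all _ fun _ => (Real.exp_pos _).le)
            (Set.Ioc_subset_Ioi_self.eventuallyLE)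
      _ = ∫ y in Set.Ioi (0 : ℝ), Real.exp (-δ * y) :=
          setIntegral_congr_fun measurableSet_Ioi fun y hy => by
            simp [abs_of_pos (Set.mem_Ioi.1 hy)]
      _ = 1 / δ := by rw [integral_exp_mul_Ioi (neg_lt_zero.2 hδ)]; simp
  · rw [intervalIntegral.integral_of_ge hx.le, abs_neg,
      abs_of_nonneg (integral_nonneg fun _ => (Real.exp_pos _).le)]
    calc _ ≤ ∫ y in Set.Iic (0 : ℝ), Real.exp (-δ * |y|) :=
          setIntegral_mono_set hint.integrableOn (ae_of_all _ fun _ => (Real.exp_pos _).le)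
            (Set.Ioc_subset_Iic_self.eventuallyLE)
      _ = ∫ y in Set.Iic (0 : ℝ), Real.exp (δ * y) :=
          setIntegral_congr_fun measurableSet_Iic fun y hy => by
            simp [abs_of_nonpos (Set.mem_Iic.1 hy)]
      _ = 1 / δ := by rw [integral_exp_mul_Iic hδ]; simp

/-- A primitive of an exponentially decaying function is bounded. -/
theorem abs_integral_le_of_abs_le_exp {f : ℝ → ℝ} {C δ : ℝ} (hδ : 0 < δ) (hC : 0 ≤ C)
    (h : ∀ x, |f x| ≤ C * Real.exp (-δ * |x|)) (x : ℝ) :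
    |∫ y in (0 : ℝ)..x, f y| ≤ C / δ := by
  have hint := integrable_exp_neg_mul_abs hδ
  calc |∫ y in (0 : ℝ)..x, f y| ≤ |∫ y in (0 : ℝ)..x, C * Real.exp (-δ * |y|)| :=
        intervalIntegral.norm_integral_le_abs_of_norm_le (f := f)
          (ae_of_all _ fun y => h y) (hint.const_mul C).intervalIntegrable
    _ = C * |∫ y in (0 : ℝ)..x, Real.exp (-δ * |y|)| := by
        rw [intervalIntegral.integral_const_mul, abs_mul, abs_of_nonneg hC]
    _ ≤ C * (1 / δ) := by gcongr; exact integral_exp_neg_mul_abs_le hδ x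
    _ = C / δ := by ring

/-- Integration by parts against a distribution function. -/
theorem integral_mul_density_eq {η η' F p : ℝ → ℝ} {C C' δ M : ℝ} (hδ : 0 < δ)
    (hη : ∀ x, HasDerivAt η (η' x) x) (hη0 : η 0 = 0) (hηM : ∀ x, |η x| ≤ M)
    (hη'c : Continuous η') (hη' : ∀ x, |η' x| ≤ C * Real.exp (-δ * |x|))
    (hF : ∀ x, HasDerivAt F (p x) x) (hp : Integrable p)
    (htail : ∀ x, |F x - unitStep x| ≤ C' * Real.exp (-δ * |x|)) :
    ∫ x, η x * p x = -∫ x, η' x * (F x - unitStep x) := by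
  have hηc : Continuous η := continuous_iff_continuousAt.2 fun x => (hη x).continuousAt
  have hFc : Continuous F := continuous_iff_continuousAt.2 fun x => (hF x).continuousAt
  have hmeas : AEStronglyMeasurable (fun x => F x - unitStep x) :=
    (hFc.measurable.sub measurable_unitStep).aestronglyMeasurable
  have hi1 : Integrable fun x => η x * p x :=
    hp.bdd_mul hηc.aestronglyMeasurable (ae_of_all _ hηM)
  have hFi : Integrable fun x => F x - unitStep x := integrable_of_abs_le_exp hδ hmeas htail
  have hη'b : ∀ x, ‖η' x‖ ≤ C := fun x => by
    have hC : 0 ≤ C := by simpa using (abs_nonneg _).trans (hη' 0)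
    refine (hη' x).trans (mul_le_of_le_one_right hC ?_)
    exact Real.exp_le_one_iff.2 (by nlinarith [abs_nonneg x])
  have hi2 : Integrable fun x => η' x * (F x - unitStep x) :=
    hFi.bdd_mul hη'c.aestronglyMeasurable (ae_of_all _ hη'b)
  have hexp : Tendsto (fun x : ℝ => M * (C' * Real.exp (-δ * |x|))) (cocompact ℝ) (𝓝 0) := by
    have h1 : Tendsto (fun x : ℝ => -δ * |x|) (cocompact ℝ) atBot :=
      (tendsto_norm_cocompact_atTop (E := ℝ)).const_mul_atTop_of_neg (neg_lt_zero.2 hδ)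
    simpa using ((Real.tendsto_exp_atBot.comp h1).const_mul C').const_mul M
  have hlim : Tendsto (fun x => η x * (F x - unitStep x)) (cocompact ℝ) (𝓝 0) := by
    refine squeeze_zero_norm (fun x => ?_) hexp
    rw [norm_mul]
    exact mul_le_mul (hηM x) (htail x) (norm_nonneg _) ((abs_nonneg _).trans (hηM x))
  rw [cocompact_eq_atBot_atTop, tendsto_sup] at hlim
  -- The half-lines are treated separately, with antiderivatives F - 1 on the right and F on the
  -- left, so that each decays at its infinity. The jump at 0 contributes nothing because η 0 = 0.
  have hright := integral_Ioi_mul_deriv_eq_deriv_mul (a := 0) (u := η) (v := fun x => F x - 1)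
    (a' := 0) (b' := 0)
    (fun x _ => hη x) (fun x _ => (hF x).sub_const 1) hi1.integrableOn
    (hi2.integrableOn.congr_fun (fun x hx => by simp [unitStep_of_pos (Set.mem_Ioi.1 hx)])
      measurableSet_Ioi)
    (by
      have : Tendsto (η * fun x => F x - 1) (𝓝 0) (𝓝 (η 0 * (F 0 - 1))) :=
        (hηc.mul (hFc.sub continuous_const)).tendsto 0
      rw [hη0, zero_mul] at this
      exact this.mono_left nhdsWithin_le_nhds)
    (hlim.2.congr' (by
      filter_upwards [eventually_gt_atTop 0] with x hx
      simp [unitStep_of_pos hx]))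
  have hleft := integral_Iic_mul_deriv_eq_deriv_mul (a := 0) (u := η) (v := F)
    (a' := 0) (b' := 0)
    (fun x _ => hη x) (fun x _ => hF x) hi1.integrableOn
    (hi2.integrableOn.congr_fun (fun x hx => by simp [unitStep_of_nonpos (Set.mem_Iic.1 hx)])
      measurableSet_Iic)
    (by
      have : Tendsto (η * F) (𝓝 0) (𝓝 (η 0 * F 0)) := (hηc.mul hFc).tendsto 0
      rw [hη0, zero_mul] at this
      exact this.mono_left nhdsWithin_le_nhds)
    (hlim.1.congr' (by
      filter_upwards [eventually_le_atBot 0] with x hx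
      simp [unitStep_of_nonpos hx]))
  rw [← intervalIntegral.integral_Iic_add_Ioi (b := 0) hi1.integrableOn hi1.integrableOn,
    ← intervalIntegral.integral_Iic_add_Ioi (b := 0) hi2.integrableOn hi2.integrableOn,
    hright, hleft,
    setIntegral_congr_fun (f := fun x => η' x * (F x - unitStep x)) (g := fun x => η' x * F x)
      measurableSet_Iic (fun x hx => by simp [unitStep_of_nonpos (Set.mem_Iic.1 hx)]),
    setIntegral_congr_fun (f := fun x => η' x * (F x - unitStep x))
      (g := fun x => η' x * (F x - 1)) measurableSet_Ioi
      (fun x hx => by simp [unitStep_of_pos (Set.mem_Ioi.1 hx)])]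
  ring

/-! ### First- and second-order bounds for the log-partition function -/

namespace IsConfining

variable {K δ A M : ℝ} {f σ : ℝ → ℝ}

theorem integrable_exp_add (hf : IsConfining K δ A f) (hδ : 0 < δ) (hσ : Continuous σ)
    (hM : ∀ x, |σ x| ≤ M) : Integrable fun x => Real.exp (f x + σ x) := by
  simp only [Real.exp_add]
  refine (hf.integrable_exp hδ).mul_bdd (c := Real.exp M) hσ.rexp.aestronglyMeasurable
    (ae_of_all _ fun x => ?_)
  rw [Real.norm_eq_abs, abs_of_pos (Real.exp_pos _)]
  exact Real.exp_le_exp.2 ((le_abs_self _).trans (hM x))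

theorem integral_exp_add_pos (hf : IsConfining K δ A f) (hδ : 0 < δ) (hσ : Continuous σ)
    (hM : ∀ x, |σ x| ≤ M) : 0 < ∫ x, Real.exp (f x + σ x) := by
  rw [integral_pos_iff_support_of_nonneg (fun x => (Real.exp_pos _).le)
    (hf.integrable_exp_add hδ hσ hM)]
  simp [Function.support, Real.exp_ne_zero]

theorem integrable_mul_density (hf : IsConfining K δ A f) (hδ : 0 < δ) (hσ : Continuous σ)
    (hM : ∀ x, |σ x| ≤ M) : Integrable fun x => σ x * (Real.exp (f x) / ∫ y, Real.exp (f y)) :=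
  ((hf.integrable_exp hδ).div_const _).bdd_mul hσ.aestronglyMeasurable (ae_of_all _ hM)

theorem integral_density (hf : IsConfining K δ A f) (hδ : 0 < δ) :
    ∫ x, Real.exp (f x) / ∫ y, Real.exp (f y) = 1 := by
  rw [integral_div, div_self (hf.integral_pos hδ).ne']

/-- Jensen's inequality for the log-partition function. -/
theorem le_log_integral_exp_add (hf : IsConfining K δ A f) (hδ : 0 < δ) (hσ : Continuous σ)
    (hM : ∀ x, |σ x| ≤ M) :
    Real.log (∫ x, Real.exp (f x)) + ∫ x, σ x * (Real.exp (f x) / ∫ y, Real.exp (f y))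
      ≤ Real.log (∫ x, Real.exp (f x + σ x)) := by
  have hZ := hf.integral_pos hδ
  have hd := (hf.integrable_exp hδ).div_const (∫ y, Real.exp (f y))
  have hi := hf.integrable_mul_density hδ hσ hM
  set Z := ∫ y, Real.exp (f y) with hZdef
  set μ := ∫ x, σ x * (Real.exp (f x) / Z) with hμ
  rw [Real.le_log_iff_exp_le (hf.integral_exp_add_pos hδ hσ hM), Real.exp_add, Real.exp_log hZ]
  calc Z * Real.exp μ
      = ∫ x, (Z * Real.exp μ) * ((1 - μ) * (Real.exp (f x) / Z) + σ x * (Real.exp (f x) / Z)) := by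
        rw [integral_const_mul, integral_add (hd.const_mul _) hi, integral_const_mul,
          hf.integral_density hδ, ← hμ]
        ring
    _ ≤ ∫ x, Real.exp (f x + σ x) := by
        refine integral_mono (((hd.const_mul _).add hi).const_mul _)
          (hf.integrable_exp_add hδ hσ hM) fun x => ?_
        -- Jensen in its tangent-line form: the tangent to exp at the mean μ integrates exactly to
        -- the claimed lower bound.
        have h1 : σ x - μ + 1 ≤ Real.exp (σ x - μ) := Real.add_one_le_exp _
        have h2 : Real.exp (f x + σ x) = Real.exp (f x) * Real.exp μ * Real.exp (σ x - μ) := by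
          rw [← Real.exp_add, ← Real.exp_add]
          ring_nf
        calc (Z * Real.exp μ) * ((1 - μ) * (Real.exp (f x) / Z) + σ x * (Real.exp (f x) / Z))
            = Real.exp (f x) * Real.exp μ * (σ x - μ + 1) := by field_simp; ring
          _ ≤ Real.exp (f x) * Real.exp μ * Real.exp (σ x - μ) := by gcongr
          _ = Real.exp (f x + σ x) := h2.symm

/-- Second-order upper bound for the log-partition function. -/
theorem log_integral_exp_add_le (hf : IsConfining K δ A f) (hδ : 0 < δ) (hσ : Continuous σ)
    (hM : ∀ x, |σ x| ≤ M) (hM1 : M ≤ 1) :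
    Real.log (∫ x, Real.exp (f x + σ x))
      ≤ Real.log (∫ x, Real.exp (f x))
        + (∫ x, σ x * (Real.exp (f x) / ∫ y, Real.exp (f y))) + M ^ 2 := by
  have hZ := hf.integral_pos hδ
  have hd := (hf.integrable_exp hδ).div_const (∫ y, Real.exp (f y))
  have hi := hf.integrable_mul_density hδ hσ hM
  set Z := ∫ y, Real.exp (f y) with hZdef
  set μ := ∫ x, σ x * (Real.exp (f x) / Z) with hμ
  rw [Real.log_le_iff_le_exp (hf.integral_exp_add_pos hδ hσ hM), add_assoc, Real.exp_add,
    Real.exp_log hZ]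
  calc ∫ x, Real.exp (f x + σ x)
      ≤ ∫ x, Z * ((1 + M ^ 2) * (Real.exp (f x) / Z) + σ x * (Real.exp (f x) / Z)) := by
        refine integral_mono (hf.integrable_exp_add hδ hσ hM)
          (((hd.const_mul _).add hi).const_mul _) fun x => ?_
        -- For |σ| ≤ 1 one has exp σ ≤ 1 + σ + σ²; this is where M ≤ 1 enters.
        have h1 := (abs_le.1 (Real.abs_exp_sub_one_sub_id_le ((hM x).trans hM1))).2
        have h2 : σ x ^ 2 ≤ M ^ 2 := sq_le_sq' (by linarith [(abs_le.1 (hM x)).1])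
          (abs_le.1 (hM x)).2
        calc Real.exp (f x + σ x) = Real.exp (f x) * Real.exp (σ x) := Real.exp_add _ _
          _ ≤ Real.exp (f x) * (1 + M ^ 2 + σ x) := by gcongr; linarith
          _ = _ := by field_simp
    _ = Z * (μ + M ^ 2 + 1) := by
        rw [integral_const_mul, integral_add (hd.const_mul _) hi, integral_const_mul,
          hf.integral_density hδ, ← hμ]
        ring
    _ ≤ Z * Real.exp (μ + M ^ 2) := by gcongr; exact Real.add_one_le_exp _

end IsConfining

/-! ### Primitives of step-like functions -/

theorem integral_unitStep (x : ℝ) : ∫ y in (0 : ℝ)..x, unitStep y = max x 0 := by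
  rcases le_or_gt x 0 with hx | hx
  · rw [max_eq_right hx, intervalIntegral.integral_of_ge hx,
      setIntegral_congr_fun (g := fun _ => (0 : ℝ)) measurableSet_Ioc
        fun y hy => unitStep_of_nonpos hy.2]
    simp
  · rw [max_eq_left hx.le, intervalIntegral.integral_of_le hx.le,
      setIntegral_congr_fun (g := fun _ => (1 : ℝ)) measurableSet_Ioc
        fun y hy => unitStep_of_pos hy.1]
    simp [hx.le]

theorem intervalIntegrable_unitStep (a b : ℝ) : IntervalIntegrable unitStep volume a b := by
  refine (intervalIntegrable_const (c := (1 : ℝ))).mono_fun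
    measurable_unitStep.aestronglyMeasurable (ae_of_all _ fun x => ?_)
  rcases le_or_gt x 0 with hx | hx
  · simp [unitStep_of_nonpos hx]
  · simp [unitStep_of_pos hx]

namespace IsStepLike

variable {C δ L : ℝ} {f : ℝ → ℝ}

theorem hasDerivAt_primitive (hf : IsStepLike C δ L f) (x : ℝ) :
    HasDerivAt (fun x => ∫ y in (0 : ℝ)..x, f y) (f x) x :=
  intervalIntegral.integral_hasDerivAt_right (hf.continuous.intervalIntegrable _ _)
    (hf.continuous.stronglyMeasurableAtFilter _ _) hf.continuous.continuousAt

/-- The step has primitive max x 0, and the difference from it is exponentially small, hence has a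
bounded primitive. All asymptotics of the potentials rest on this. -/
theorem abs_primitive_sub_le (hf : IsStepLike C δ L f) (hδ : 0 < δ) (x : ℝ) :
    |(∫ y in (0 : ℝ)..x, f y) - max x 0| ≤ C / δ := by
  rw [← integral_unitStep, ← intervalIntegral.integral_sub (hf.continuous.intervalIntegrable _ _)
    (intervalIntegrable_unitStep _ _)]
  exact abs_integral_le_of_abs_le_exp hδ hf.coeff_nonneg hf.tail x

theorem primitive_mem_of_nonneg (hf : IsStepLike C δ L f) {x : ℝ} (hx : 0 ≤ x) :
    0 ≤ (∫ y in (0 : ℝ)..x, f y) ∧ (∫ y in (0 : ℝ)..x, f y) ≤ x := by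
  refine ⟨intervalIntegral.integral_nonneg hx fun y _ => hf.nonneg y, ?_⟩
  calc (∫ y in (0 : ℝ)..x, f y) ≤ ∫ y in (0 : ℝ)..x, (1 : ℝ) :=
        intervalIntegral.integral_mono hx (hf.continuous.intervalIntegrable _ _)
          intervalIntegrable_const hf.le_one
    _ = x := by simp

theorem primitive_mem_of_nonpos (hf : IsStepLike C δ L f) {x : ℝ} (hx : x ≤ 0) :
    x ≤ (∫ y in (0 : ℝ)..x, f y) ∧ (∫ y in (0 : ℝ)..x, f y) ≤ 0 := by
  rw [intervalIntegral.integral_symm]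
  refine ⟨?_, neg_nonpos.2 (intervalIntegral.integral_nonneg hx fun y _ => hf.nonneg y)⟩
  have : (∫ y in x..0, f y) ≤ ∫ y in x..0, (1 : ℝ) :=
    intervalIntegral.integral_mono hx (hf.continuous.intervalIntegrable _ _)
      intervalIntegrable_const hf.le_one
  simp at this
  linarith

theorem abs_primitive_le (hf : IsStepLike C δ L f) (x : ℝ) :
    |∫ y in (0 : ℝ)..x, f y| ≤ |x| := by
  rcases le_total 0 x with hx | hx
  · obtain ⟨h1, h2⟩ := hf.primitive_mem_of_nonneg hx
    rwa [abs_of_nonneg h1, abs_of_nonneg hx]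
  · obtain ⟨h1, h2⟩ := hf.primitive_mem_of_nonpos hx
    rw [abs_of_nonpos h2, abs_of_nonpos hx]
    linarith

theorem primitive_convex_comb (hf : IsStepLike C δ L f) {C' L' : ℝ} {h : ℝ → ℝ}
    (hh : IsStepLike C' δ L' h) (ε x : ℝ) :
    ∫ y in (0 : ℝ)..x, (f y + ε * (h y - f y))
      = (∫ y in (0 : ℝ)..x, f y)
        + ε * ((∫ y in (0 : ℝ)..x, h y) - ∫ y in (0 : ℝ)..x, f y) := by
  have h1 := hf.continuous.intervalIntegrable (μ := volume) 0 x
  have h2 := hh.continuous.intervalIntegrable (μ := volume) 0 x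
  rw [intervalIntegral.integral_add h1 ((h2.sub h1).const_mul ε),
    intervalIntegral.integral_const_mul, intervalIntegral.integral_sub h2 h1]

theorem continuousOn_primitive {X : Type*} [TopologicalSpace X] [FirstCountableTopology X]
    {S : Set X} {F : X → C(ℝ, ℝ)} (hF : ContinuousOn F S)
    (hS : ∀ p ∈ S, IsStepLike C δ L (F p)) (x : ℝ) :
    ContinuousOn (fun p => ∫ y in (0 : ℝ)..x, F p y) S := by
  intro p hp
  refine intervalIntegral.continuousWithinAt_of_dominated_interval (bound := fun _ => 1) ?_ ?_
    intervalIntegrable_const (ae_of_all _ fun t _ => ?_)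
  · exact Eventually.of_forall fun q => (F q).continuous.aestronglyMeasurable
  · filter_upwards [self_mem_nhdsWithin] with q hq
    refine ae_of_all _ fun t _ => ?_
    rw [Real.norm_eq_abs, abs_of_nonneg ((hS q hq).nonneg t)]
    exact (hS q hq).le_one t
  · exact ((ContinuousEvalConst.continuous_eval_const t).comp_continuousOn hF) p hp

end IsStepLike

theorem continuousOn_integral_of_abs_le_exp {X : Type*} [TopologicalSpace X]
    [FirstCountableTopology X] {S : Set X} {F : X → ℝ → ℝ} {C δ : ℝ} (hδ : 0 < δ)
    (hmeas : ∀ p ∈ S, AEStronglyMeasurable (F p))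
    (hbound : ∀ p ∈ S, ∀ x, |F p x| ≤ C * Real.exp (-δ * |x|))
    (hcont : ∀ x, ContinuousOn (fun p => F p x) S) :
    ContinuousOn (fun p => ∫ x, F p x) S := by
  intro p hp
  refine continuousWithinAt_of_dominated (bound := fun x => C * Real.exp (-δ * |x|)) ?_ ?_
    ((integrable_exp_neg_mul_abs hδ).const_mul C) (ae_of_all _ fun x => hcont x p hp)
  · filter_upwards [self_mem_nhdsWithin] with q hq using hmeas q hq
  · filter_upwards [self_mem_nhdsWithin] with q hq using ae_of_all _ (hbound q hq)

theorem sq_le_of_abs_le_exp {a C δ x : ℝ} (hδ : 0 ≤ δ) (h : |a| ≤ C * Real.exp (-δ * |x|)) :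
    a ^ 2 ≤ C ^ 2 * Real.exp (-δ * |x|) := by
  have h1 : Real.exp (-δ * |x|) ≤ 1 := Real.exp_le_one_iff.2 (by nlinarith [abs_nonneg x])
  calc a ^ 2 = |a| ^ 2 := (sq_abs a).symm
    _ ≤ (C * Real.exp (-δ * |x|)) ^ 2 := by gcongr
    _ = C ^ 2 * (Real.exp (-δ * |x|) * Real.exp (-δ * |x|)) := by ring
    _ ≤ C ^ 2 * (Real.exp (-δ * |x|) * 1) := by gcongr
    _ = _ := by ring

theorem eq_zero_of_integral_sq_eq_zero {f : ℝ → ℝ} (hf : Continuous f)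
    (hi : Integrable fun x => f x ^ 2) (h : ∫ x, f x ^ 2 = 0) (x : ℝ) : f x = 0 := by
  rw [integral_eq_zero_iff_of_nonneg (fun x => sq_nonneg (f x)) hi] at h
  have := ((hf.pow 2).ae_eq_iff_eq volume continuous_const).1 h
  exact (pow_eq_zero_iff two_ne_zero).1 (congrFun this x)

/-! ### The normalised system and its invariant class -/

/-- Parameters of the normalised wall system: `α, β` are the decay rates of the first density at
`±∞`, `n, m` the total masses of the two densities, `κ` the Gaussian confinement of the second one,
`c` its self-repulsion, `s` a drift, and `δ` a decay rate common to all tails. -/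
structure WallParams where
  α : ℝ
  β : ℝ
  m : ℝ
  n : ℝ
  κ : ℝ
  c : ℝ
  s : ℝ
  δ : ℝ
  β_pos : 0 < β
  m_pos : 0 < m
  n_pos : 0 < n
  κ_pos : 0 < κ
  c_pos : 0 < c
  δ_pos : 0 < δ
  balance : m + n = α + β
  δ_le_α : δ ≤ m - α
  δ_le_β : δ ≤ m - β

namespace WallParams

variable (D : WallParams)

/-- The potential whose Gibbs density is the first component. -/
noncomputable def potU (P Q : ℝ → ℝ) (x : ℝ) : ℝ :=
  D.β * x - (D.m * (∫ y in (0 : ℝ)..x, Q y) + D.n * ∫ y in (0 : ℝ)..x, P y)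

/-- The potential whose Gibbs density is the second component. -/
noncomputable def potV (P Q : ℝ → ℝ) (x : ℝ) : ℝ :=
  -D.s * x - D.κ * x ^ 2
    + (D.m * (1 + D.c) * (∫ y in (0 : ℝ)..x, Q y) + D.n * ∫ y in (0 : ℝ)..x, P y) / 2

/-- A bound for the slope of `potV` relative to its Gaussian part. -/
noncomputable def slopeV : ℝ := |D.s| + (D.m * (1 + D.c) + D.n) / 2

/-- The height of the tent above `potV`. -/
noncomputable def heightV : ℝ := (D.slopeV + D.δ) ^ 2 / (4 * D.κ)

/-- The Lipschitz constant of the second distribution function. -/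
noncomputable def lipV : ℝ := Real.exp (D.heightV + (|D.s| + D.κ))

/-- The height of the tent above `potU`. -/
noncomputable def heightU : ℝ := D.m * (D.lipV / D.δ / D.δ)

/-- The Lipschitz constant of the first distribution function. -/
noncomputable def lipU : ℝ := Real.exp (D.heightU + (D.m + D.n))

/-- The admissible class for the first distribution function. -/
def AdmU (P : ℝ → ℝ) : Prop := IsStepLike (D.lipU / D.δ) D.δ D.lipU P

/-- The admissible class for the second distribution function. -/
def AdmV (Q : ℝ → ℝ) : Prop := IsStepLike (D.lipV / D.δ) D.δ D.lipV Q

variable {D} {P Q : ℝ → ℝ} {C δ L C' δ' L' : ℝ}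

theorem hasDerivAt_potU (hP : IsStepLike C δ L P) (hQ : IsStepLike C' δ' L' Q) (x : ℝ) :
    HasDerivAt (D.potU P Q) (D.β - (D.m * Q x + D.n * P x)) x := by
  have h := ((hasDerivAt_id x).const_mul D.β).sub
    (((hQ.hasDerivAt_primitive x).const_mul D.m).add ((hP.hasDerivAt_primitive x).const_mul D.n))
  simpa using! h

theorem hasDerivAt_potV (hP : IsStepLike C δ L P) (hQ : IsStepLike C' δ' L' Q) (x : ℝ) :
    HasDerivAt (D.potV P Q)
      (-D.s - 2 * D.κ * x + (D.m * (1 + D.c) * Q x + D.n * P x) / 2) x := by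
  have h := (((hasDerivAt_id x).const_mul (-D.s)).sub ((hasDerivAt_pow 2 x).const_mul D.κ)).add
    ((((hQ.hasDerivAt_primitive x).const_mul (D.m * (1 + D.c))).add
      ((hP.hasDerivAt_primitive x).const_mul D.n)).div_const 2)
  refine h.congr_deriv ?_
  simp
  ring

/-- The Gaussian term beats the linear growth of the primitives, for which |∫₀ˣ f| ≤ |x| suffices.
The bounds therefore do not depend on the constants of P and Q, so the class for Q can be fixed
before the class for P. -/
theorem isConfining_potV (hP : IsStepLike C δ L P) (hQ : IsStepLike C' δ' L' Q) :
    IsConfining D.heightV D.δ (|D.s| + D.κ) (D.potV P Q) := by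
  have hm := D.m_pos
  have hn := D.n_pos
  have hκ := D.κ_pos
  have hc := D.c_pos
  have hmc : 0 < D.m * (1 + D.c) := by positivity
  refine ⟨continuous_iff_continuousAt.2 fun x => (hasDerivAt_potV hP hQ x).continuousAt,
    fun x => ?_, fun x hx => ?_⟩
  · have h1 := (abs_le.1 (hQ.abs_primitive_le x)).2
    have h2 := (abs_le.1 (hP.abs_primitive_le x)).2
    have h3 : -D.s * x ≤ |D.s| * |x| := by
      rw [← abs_mul]
      exact (le_abs_self _).trans_eq (by rw [neg_mul, abs_neg])
    have h4 : D.potV P Q x ≤ D.slopeV * |x| - D.κ * |x| ^ 2 := by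
      rw [potV, slopeV, sq_abs]
      nlinarith [mul_le_mul_of_nonneg_left h1 hmc.le, mul_le_mul_of_nonneg_left h2 hn.le]
    -- `heightV` is the maximum of the parabola (slopeV + δ)t - κt².
    have h5 : (D.slopeV + D.δ) * |x| - D.κ * |x| ^ 2 ≤ D.heightV := by
      rw [heightV, le_div_iff₀ (by positivity)]
      nlinarith [sq_nonneg (2 * D.κ * |x| - (D.slopeV + D.δ))]
    linarith
  · have h1 := (hQ.primitive_mem_of_nonneg hx.1).1
    have h2 := (hP.primitive_mem_of_nonneg hx.1).1
    have h3 : -|D.s| ≤ -D.s * x := by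
      have : D.s * x ≤ |D.s| * 1 := mul_le_mul (le_abs_self _) hx.2 hx.1 (abs_nonneg _)
      linarith
    have h4 : D.κ * x ^ 2 ≤ D.κ * 1 := by
      gcongr
      exact pow_le_one₀ hx.1 hx.2
    have h5 := mul_nonneg hmc.le h1
    have h6 := mul_nonneg hn.le h2
    rw [potV]
    linarith

/-- Only the tail of Q is used quantitatively; for P the bounds 0 ≤ P ≤ 1 suffice. On the right the
slope is at most β - m ≤ -δ. On the left the worst case P = 1 leaves slope β - n = m - α ≥ δ. Thus
the confinement condition is m > max(α, β). -/
theorem isConfining_potU (hP : IsStepLike C δ L P) (hQ : D.AdmV Q) :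
    IsConfining D.heightU D.δ (D.m + D.n) (D.potU P Q) := by
  have hm := D.m_pos
  have hn := D.n_pos
  refine ⟨continuous_iff_continuousAt.2 fun x => (hasDerivAt_potU hP hQ x).continuousAt,
    fun x => ?_, fun x hx => ?_⟩
  · have h1 := mul_le_mul_of_nonneg_left (abs_le.1 (hQ.abs_primitive_sub_le D.δ_pos x)).1 hm.le
    rw [potU, heightU]
    rcases le_total 0 x with hx | hx
    · have h2 := mul_nonneg hn.le (hP.primitive_mem_of_nonneg hx).1
      rw [abs_of_nonneg hx]
      rw [max_eq_left hx] at h1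
      nlinarith [mul_le_mul_of_nonneg_right D.δ_le_β hx]
    · have h2 := mul_le_mul_of_nonneg_left (hP.primitive_mem_of_nonpos hx).1 hn.le
      rw [abs_of_nonpos hx]
      rw [max_eq_right hx] at h1
      nlinarith [mul_le_mul_of_nonpos_right D.δ_le_α hx, D.balance]
  · have h1 := mul_le_mul_of_nonneg_left (hQ.primitive_mem_of_nonneg hx.1).2 hm.le
    have h2 := mul_le_mul_of_nonneg_left (hP.primitive_mem_of_nonneg hx.1).2 hn.le
    have h3 := mul_nonneg D.β_pos.le hx.1
    rw [potU]
    nlinarith [hx.2]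

theorem admV_gibbsCdf (hP : IsStepLike C δ L P) (hQ : IsStepLike C' δ' L' Q) :
    D.AdmV (gibbsCdf (D.potV P Q)) :=
  (isConfining_potV hP hQ).isStepLike_gibbsCdf D.δ_pos

theorem admU_gibbsCdf (hP : IsStepLike C δ L P) (hQ : D.AdmV Q) :
    D.AdmU (gibbsCdf (D.potU P Q)) :=
  (isConfining_potU hP hQ).isStepLike_gibbsCdf D.δ_pos

/-- Two applications of the Gibbs map suffice: `potV` accepts any step-like input, here the
distribution function of a tent, and once Q is admissible `potU` yields an admissible P. -/
theorem exists_adm (D : WallParams) : ∃ P Q, D.AdmU P ∧ D.AdmV Q := by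
  have h0 : IsConfining 0 D.δ D.δ (fun x => -D.δ * |x|) :=
    ⟨by fun_prop, fun x => by simp, fun x hx => by
      rw [abs_of_nonneg hx.1]
      nlinarith [hx.2, D.δ_pos]⟩
  have h1 := h0.isStepLike_gibbsCdf D.δ_pos
  have h2 := admV_gibbsCdf (D := D) h1 h1
  exact ⟨_, _, admU_gibbsCdf h1 h2, h2⟩

/-! ### The energy and its minimiser -/

variable (D) in
/-- The energy whose gradient is the displacement of the Gibbs map. -/
noncomputable def energy (P Q : ℝ → ℝ) : ℝ :=
  (∫ x, (D.m * (Q x - unitStep x) + D.n * (P x - unitStep x)) ^ 2) / 2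
    + D.c * D.m ^ 2 / 2 * (∫ x, (Q x - unitStep x) ^ 2)
    + 2 * D.m * Real.log (∫ x, Real.exp (D.potV P Q x))
    - D.n * Real.log (∫ x, Real.exp (D.potU P Q x))

theorem abs_lin_le {a b A B E : ℝ} (D : WallParams) (ha : |a| ≤ A * E) (hb : |b| ≤ B * E) :
    |D.m * a + D.n * b| ≤ (D.m * A + D.n * B) * E := by
  calc |D.m * a + D.n * b| ≤ |D.m * a| + |D.n * b| := abs_add_le _ _
    _ = D.m * |a| + D.n * |b| := by
      rw [abs_mul, abs_mul, abs_of_pos D.m_pos, abs_of_pos D.n_pos]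
    _ ≤ D.m * (A * E) + D.n * (B * E) := by
      have := D.m_pos
      have := D.n_pos
      gcongr
    _ = _ := by ring

/-- Dominated convergence: on the admissible class each integrand has an exponential majorant
independent of the pair, and evaluations and primitives at a point depend continuously on it. -/
theorem continuousOn_energy (D : WallParams) :
    ContinuousOn (fun p : C(ℝ, ℝ) × C(ℝ, ℝ) => D.energy p.1 p.2)
      {p | D.AdmU p.1 ∧ D.AdmV p.2} := by
  have hδ := D.δ_pos
  have hP : ∀ x, ContinuousOn (fun p : C(ℝ, ℝ) × C(ℝ, ℝ) => p.1 x)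
      {p | D.AdmU p.1 ∧ D.AdmV p.2} := fun x =>
    ((ContinuousEvalConst.continuous_eval_const x).comp continuous_fst).continuousOn
  have hQ : ∀ x, ContinuousOn (fun p : C(ℝ, ℝ) × C(ℝ, ℝ) => p.2 x)
      {p | D.AdmU p.1 ∧ D.AdmV p.2} := fun x =>
    ((ContinuousEvalConst.continuous_eval_const x).comp continuous_snd).continuousOn
  have hIP := fun x => IsStepLike.continuousOn_primitive
    (S := {p : C(ℝ, ℝ) × C(ℝ, ℝ) | D.AdmU p.1 ∧ D.AdmV p.2}) continuousOn_fst
    (fun p hp => hp.1) x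
  have hIQ := fun x => IsStepLike.continuousOn_primitive
    (S := {p : C(ℝ, ℝ) × C(ℝ, ℝ) | D.AdmU p.1 ∧ D.AdmV p.2}) continuousOn_snd
    (fun p hp => hp.2) x
  have hmU : Measurable unitStep := measurable_unitStep
  have hm1 : ∀ f : C(ℝ, ℝ), Measurable f := fun f => f.continuous.measurable
  unfold energy
  refine ContinuousOn.sub (ContinuousOn.add (ContinuousOn.add ?_ ?_) ?_) ?_
  · refine ContinuousOn.div_const ?_ 2
    refine continuousOn_integral_of_abs_le_exp hδ (fun p _ => ?_)
      (C := (D.m * (D.lipV / D.δ) + D.n * (D.lipU / D.δ)) ^ 2) (fun p hp x => ?_) fun x => ?_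
    · have := hm1 p.1
      have := hm1 p.2
      exact Measurable.aestronglyMeasurable (by fun_prop)
    · rw [abs_of_nonneg (sq_nonneg _)]
      exact sq_le_of_abs_le_exp hδ.le (D.abs_lin_le (hp.2.tail x) (hp.1.tail x))
    · have := hP x
      have := hQ x
      fun_prop
  · refine ContinuousOn.mul continuousOn_const ?_
    refine continuousOn_integral_of_abs_le_exp hδ (fun p _ => ?_)
      (C := (D.lipV / D.δ) ^ 2) (fun p hp x => ?_) fun x => ?_
    · have := hm1 p.2
      exact Measurable.aestronglyMeasurable (by fun_prop)
    · rw [abs_of_nonneg (sq_nonneg _)]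
      exact sq_le_of_abs_le_exp hδ.le (hp.2.tail x)
    · have := hQ x
      fun_prop
  · refine ContinuousOn.mul continuousOn_const (ContinuousOn.log ?_ fun p hp =>
      ((isConfining_potV hp.1 hp.2).integral_pos hδ).ne')
    refine continuousOn_integral_of_abs_le_exp hδ (fun p hp => ?_)
      (C := Real.exp D.heightV) (fun p hp x => ?_) fun x => ?_
    · exact (isConfining_potV hp.1 hp.2).continuous.rexp.aestronglyMeasurable
    · rw [abs_of_pos (Real.exp_pos _)]
      exact (isConfining_potV hp.1 hp.2).exp_le x
    · have h1 := hIP x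
      have h2 := hIQ x
      unfold potV
      fun_prop
  · refine ContinuousOn.mul continuousOn_const (ContinuousOn.log ?_ fun p hp =>
      ((isConfining_potU hp.1 hp.2).integral_pos hδ).ne')
    refine continuousOn_integral_of_abs_le_exp hδ (fun p hp => ?_)
      (C := Real.exp D.heightU) (fun p hp x => ?_) fun x => ?_
    · exact (isConfining_potU hp.1 hp.2).continuous.rexp.aestronglyMeasurable
    · rw [abs_of_pos (Real.exp_pos _)]
      exact (isConfining_potU hp.1 hp.2).exp_le x
    · have h1 := hIP x
      have h2 := hIQ x
      unfold potU
      fun_prop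

theorem exists_energy_min (D : WallParams) : ∃ P Q, D.AdmU P ∧ D.AdmV Q ∧
    ∀ P' Q', D.AdmU P' → D.AdmV Q' → D.energy P Q ≤ D.energy P' Q' := by
  have hK : IsCompact {p : C(ℝ, ℝ) × C(ℝ, ℝ) | D.AdmU p.1 ∧ D.AdmV p.2} :=
    (isCompact_setOf_isStepLike _ _ _).prod (isCompact_setOf_isStepLike _ _ _)
  obtain ⟨P₀, Q₀, hP₀, hQ₀⟩ := D.exists_adm
  obtain ⟨p, hp, hmin⟩ := hK.exists_isMinOn
    ⟨(⟨P₀, hP₀.continuous⟩, ⟨Q₀, hQ₀.continuous⟩), hP₀, hQ₀⟩ D.continuousOn_energy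
  refine ⟨p.1, p.2, hp.1, hp.2, fun P' Q' hP' hQ' => ?_⟩
  exact hmin (a := (⟨P', hP'.continuous⟩, ⟨Q', hQ'.continuous⟩)) ⟨hP', hQ'⟩

end WallParams

/-! ### The first variation of the energy -/

/-- Measurable functions of exponential decay at rate `δ`. -/
def ExpDecay (δ : ℝ) (f : ℝ → ℝ) : Prop :=
  Measurable f ∧ ∃ C, ∀ x, |f x| ≤ C * Real.exp (-δ * |x|)

namespace ExpDecay

variable {δ : ℝ} {f h : ℝ → ℝ}

theorem const_mul (hf : ExpDecay δ f) (a : ℝ) : ExpDecay δ fun x => a * f x := by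
  obtain ⟨hm, C, hC⟩ := hf
  refine ⟨hm.const_mul a, |a| * C, fun x => ?_⟩
  rw [abs_mul, mul_assoc]
  exact mul_le_mul_of_nonneg_left (hC x) (abs_nonneg a)

theorem add (hf : ExpDecay δ f) (hh : ExpDecay δ h) : ExpDecay δ fun x => f x + h x := by
  obtain ⟨hm, C, hC⟩ := hf
  obtain ⟨hm', C', hC'⟩ := hh
  refine ⟨hm.add hm', C + C', fun x => (abs_add_le _ _).trans ?_⟩
  rw [add_mul]
  exact add_le_add (hC x) (hC' x)

theorem integrable_mul (hδ : 0 < δ) (hf : ExpDecay δ f) (hh : ExpDecay δ h) :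
    Integrable fun x => f x * h x := by
  obtain ⟨hm, C, hC⟩ := hf
  obtain ⟨hm', C', hC'⟩ := hh
  have h0 : 0 ≤ C := by simpa using (abs_nonneg _).trans (hC 0)
  refine (integrable_of_abs_le_exp hδ hm'.aestronglyMeasurable hC').bdd_mul (c := C)
    hm.aestronglyMeasurable (ae_of_all _ fun x => (hC x).trans ?_)
  exact mul_le_of_le_one_right h0 (Real.exp_le_one_iff.2 (by nlinarith [abs_nonneg x]))

theorem integral_add_mul_sq (hδ : 0 < δ) (hf : ExpDecay δ f) (hh : ExpDecay δ h) (ε : ℝ) :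
    ∫ x, (f x + ε * h x) ^ 2
      = (∫ x, f x ^ 2) + 2 * ε * (∫ x, f x * h x) + ε ^ 2 * ∫ x, h x ^ 2 := by
  have h1 := integrable_mul hδ hf hf
  have h2 := integrable_mul hδ hf hh
  have h3 := integrable_mul hδ hh hh
  simp only [pow_two (f _), pow_two (h _)]
  have h12 : Integrable fun x => f x * f x + 2 * ε * (f x * h x) := h1.add (h2.const_mul _)
  rw [← integral_const_mul, ← integral_const_mul, ← integral_add h1 (h2.const_mul _),
    ← integral_add h12 (h3.const_mul _)]
  congr 1
  ext x
  ring

end ExpDecay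

theorem IsStepLike.expDecay {C δ L : ℝ} {f : ℝ → ℝ} (hf : IsStepLike C δ L f) :
    ExpDecay δ fun x => f x - unitStep x :=
  ⟨hf.continuous.measurable.sub measurable_unitStep, C, hf.tail⟩

theorem IsStepLike.expDecay_sub {C δ L : ℝ} {f h : ℝ → ℝ} (hf : IsStepLike C δ L f)
    (hh : IsStepLike C δ L h) : ExpDecay δ fun x => h x - f x :=
  ⟨hh.continuous.measurable.sub hf.continuous.measurable, C + C, hf.abs_sub_le hh⟩

theorem IsStepLike.abs_primitive_diff_le {C δ L : ℝ} {f h : ℝ → ℝ} (hf : IsStepLike C δ L f)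
    (hh : IsStepLike C δ L h) (hδ : 0 < δ) (x : ℝ) :
    |(∫ y in (0 : ℝ)..x, h y) - ∫ y in (0 : ℝ)..x, f y| ≤ 2 * (C / δ) := by
  have h1 := hf.abs_primitive_sub_le hδ x
  have h2 := hh.abs_primitive_sub_le hδ x
  rw [abs_le] at *
  constructor <;> linarith

namespace WallParams

variable {D : WallParams} {P Q P' Q' : ℝ → ℝ}

theorem potU_convex_comb (hP : D.AdmU P) (hQ : D.AdmV Q) (hP' : D.AdmU P') (hQ' : D.AdmV Q')
    (ε x : ℝ) :
    D.potU (fun x => P x + ε * (P' x - P x)) (fun x => Q x + ε * (Q' x - Q x)) x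
      = D.potU P Q x + ε * (D.potU P' Q' x - D.potU P Q x) := by
  simp only [potU]
  rw [hP.primitive_convex_comb hP', hQ.primitive_convex_comb hQ']
  ring

theorem potV_convex_comb (hP : D.AdmU P) (hQ : D.AdmV Q) (hP' : D.AdmU P') (hQ' : D.AdmV Q')
    (ε x : ℝ) :
    D.potV (fun x => P x + ε * (P' x - P x)) (fun x => Q x + ε * (Q' x - Q x)) x
      = D.potV P Q x + ε * (D.potV P' Q' x - D.potV P Q x) := by
  simp only [potV]
  rw [hP.primitive_convex_comb hP', hQ.primitive_convex_comb hQ']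
  ring

/-- The linear terms cancel, and both primitives stay within a bounded distance of max x 0.
Boundedness makes the perturbation small along short segments and legitimises the integration by
parts. -/
theorem exists_abs_potU_sub_le (hP : D.AdmU P) (hQ : D.AdmV Q) (hP' : D.AdmU P')
    (hQ' : D.AdmV Q') : ∃ M, ∀ x, |D.potU P' Q' x - D.potU P Q x| ≤ M := by
  refine ⟨(D.m * (2 * (D.lipV / D.δ / D.δ)) + D.n * (2 * (D.lipU / D.δ / D.δ))) * 1,
    fun x => ?_⟩
  have := D.abs_lin_le (E := 1) ((hQ.abs_primitive_diff_le hQ' D.δ_pos x).trans_eq (mul_one _).symm)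
    ((hP.abs_primitive_diff_le hP' D.δ_pos x).trans_eq (mul_one _).symm)
  rw [← abs_neg] at this
  convert this using 2
  simp only [potU]
  ring

theorem exists_abs_potV_sub_le (hP : D.AdmU P) (hQ : D.AdmV Q) (hP' : D.AdmU P')
    (hQ' : D.AdmV Q') : ∃ M, ∀ x, |D.potV P' Q' x - D.potV P Q x| ≤ M := by
  refine ⟨(D.m * ((1 + D.c) / 2 * (2 * (D.lipV / D.δ / D.δ)))
    + D.n * (1 / 2 * (2 * (D.lipU / D.δ / D.δ)))) * 1, fun x => ?_⟩
  have hc : 0 ≤ (1 + D.c) / 2 := by linarith [D.c_pos]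
  have h1 : |(1 + D.c) / 2 * ((∫ y in (0 : ℝ)..x, Q' y) - ∫ y in (0 : ℝ)..x, Q y)|
      ≤ (1 + D.c) / 2 * (2 * (D.lipV / D.δ / D.δ)) * 1 := by
    rw [abs_mul, abs_of_nonneg hc, mul_one]
    exact mul_le_mul_of_nonneg_left (hQ.abs_primitive_diff_le hQ' D.δ_pos x) hc
  have h2 : |1 / 2 * ((∫ y in (0 : ℝ)..x, P' y) - ∫ y in (0 : ℝ)..x, P y)|
      ≤ 1 / 2 * (2 * (D.lipU / D.δ / D.δ)) * 1 := by
    rw [abs_mul, abs_of_nonneg (by norm_num), mul_one]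
    exact mul_le_mul_of_nonneg_left (hP.abs_primitive_diff_le hP' D.δ_pos x) (by norm_num)
  convert D.abs_lin_le h1 h2 using 2
  simp only [potV]
  ring

/-- Moves the first variation of the log-partition function onto P, Q themselves, where it can be
combined with the quadratic part of the energy. -/
theorem integral_potU_sub_mul_density (hP : D.AdmU P) (hQ : D.AdmV Q) (hP' : D.AdmU P')
    (hQ' : D.AdmV Q') :
    ∫ x, (D.potU P' Q' x - D.potU P Q x)
        * (Real.exp (D.potU P Q x) / ∫ y, Real.exp (D.potU P Q y))
      = ∫ x, (D.m * (Q' x - Q x) + D.n * (P' x - P x))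
        * (gibbsCdf (D.potU P Q) x - unitStep x) := by
  obtain ⟨M, hM⟩ := exists_abs_potU_sub_le hP hQ hP' hQ'
  have hc := isConfining_potU (D := D) hP hQ
  obtain ⟨-, C, hC⟩ := ((hQ.expDecay_sub hQ').const_mul (-D.m)).add
    ((hP.expDecay_sub hP').const_mul (-D.n))
  rw [integral_mul_density_eq D.δ_pos
    (η := fun x => D.potU P' Q' x - D.potU P Q x)
    (η' := fun x => -D.m * (Q' x - Q x) + -D.n * (P' x - P x))
    (fun x => ((hasDerivAt_potU hP' hQ' x).sub (hasDerivAt_potU hP hQ x)).congr_deriv (by ring))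
    (by simp [potU]) hM
    ((continuous_const.mul (hQ'.continuous.sub hQ.continuous)).add
      (continuous_const.mul (hP'.continuous.sub hP.continuous))) hC
    (hc.hasDerivAt_gibbsCdf D.δ_pos) ((hc.integrable_exp D.δ_pos).div_const _)
    (admU_gibbsCdf hP hQ).tail, ← integral_neg]
  congr 1
  ext x
  ring

theorem integral_potV_sub_mul_density (hP : D.AdmU P) (hQ : D.AdmV Q) (hP' : D.AdmU P')
    (hQ' : D.AdmV Q') :
    ∫ x, (D.potV P' Q' x - D.potV P Q x)
        * (Real.exp (D.potV P Q x) / ∫ y, Real.exp (D.potV P Q y))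
      = -∫ x, (D.m * (1 + D.c) / 2 * (Q' x - Q x) + D.n / 2 * (P' x - P x))
        * (gibbsCdf (D.potV P Q) x - unitStep x) := by
  obtain ⟨M, hM⟩ := exists_abs_potV_sub_le hP hQ hP' hQ'
  have hc := isConfining_potV (D := D) hP hQ
  obtain ⟨-, C, hC⟩ := ((hQ.expDecay_sub hQ').const_mul (D.m * (1 + D.c) / 2)).add
    ((hP.expDecay_sub hP').const_mul (D.n / 2))
  exact integral_mul_density_eq D.δ_pos
    (η := fun x => D.potV P' Q' x - D.potV P Q x)
    (η' := fun x => D.m * (1 + D.c) / 2 * (Q' x - Q x) + D.n / 2 * (P' x - P x))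
    (fun x => ((hasDerivAt_potV hP' hQ' x).sub (hasDerivAt_potV hP hQ x)).congr_deriv (by ring))
    (by simp [potV]) hM
    ((continuous_const.mul (hQ'.continuous.sub hQ.continuous)).add
      (continuous_const.mul (hP'.continuous.sub hP.continuous))) hC
    (hc.hasDerivAt_gibbsCdf D.δ_pos) ((hc.integrable_exp D.δ_pos).div_const _)
    (admV_gibbsCdf hP hQ).tail

/-- Moving towards the Gibbs image lowers the energy at first order, at a rate given by the squared
displacement. -/
theorem exists_energy_convex_comb_le (hP : D.AdmU P) (hQ : D.AdmV Q)
    (hP'eq : P' = gibbsCdf (D.potU P Q)) (hQ'eq : Q' = gibbsCdf (D.potV P Q)) :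
    ∃ M > 0, ∃ B, ∀ ε, 0 ≤ ε → ε * M ≤ 1 →
      D.energy (fun x => P x + ε * (P' x - P x)) (fun x => Q x + ε * (Q' x - Q x))
        ≤ D.energy P Q
          - ε * ((∫ x, (D.m * (Q' x - Q x) + D.n * (P' x - P x)) ^ 2)
            + D.c * D.m ^ 2 * ∫ x, (Q' x - Q x) ^ 2)
          + ε ^ 2 * B := by
  have hδ := D.δ_pos
  have hP' : D.AdmU P' := hP'eq ▸ admU_gibbsCdf hP hQ
  have hQ' : D.AdmV Q' := hQ'eq ▸ admV_gibbsCdf hP hQ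
  obtain ⟨MU, hMU⟩ := exists_abs_potU_sub_le hP hQ hP' hQ'
  obtain ⟨MV, hMV⟩ := exists_abs_potV_sub_le hP hQ hP' hQ'
  have hMV0 : 0 ≤ MV := (abs_nonneg _).trans (hMV 0)
  have hcU := isConfining_potU (D := D) hP hQ
  have hcV := isConfining_potV (D := D) hP hQ
  have hηc : Continuous fun x => D.potU P' Q' x - D.potU P Q x :=
    (isConfining_potU hP' hQ').continuous.sub hcU.continuous
  have hσc : Continuous fun x => D.potV P' Q' x - D.potV P Q x :=
    (isConfining_potV hP' hQ').continuous.sub hcV.continuous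
  have dA := (hQ.expDecay.const_mul D.m).add (hP.expDecay.const_mul D.n)
  have dQ := hQ.expDecay_sub hQ'
  have dP := hP.expDecay_sub hP'
  have dD := (dQ.const_mul D.m).add (dP.const_mul D.n)
  have dE := (dQ.const_mul (D.m * (1 + D.c) / 2)).add (dP.const_mul (D.n / 2))
  have hU := integral_potU_sub_mul_density hP hQ hP' hQ'
  have hV := integral_potV_sub_mul_density hP hQ hP' hQ'
  rw [← hP'eq] at hU
  rw [← hQ'eq] at hV
  -- The weights 2m and n are chosen so that the entropic terms reproduce the quadratic form's
  -- gradient evaluated at the Gibbs image. The step cancels in the difference, leaving minus the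
  -- form of the displacement.
  have hfirst : (∫ x, (D.m * (Q x - unitStep x) + D.n * (P x - unitStep x))
        * (D.m * (Q' x - Q x) + D.n * (P' x - P x)))
      + D.c * D.m ^ 2 * (∫ x, (Q x - unitStep x) * (Q' x - Q x))
      - 2 * D.m * (∫ x, (D.m * (1 + D.c) / 2 * (Q' x - Q x) + D.n / 2 * (P' x - P x))
        * (Q' x - unitStep x))
      - D.n * (∫ x, (D.m * (Q' x - Q x) + D.n * (P' x - P x)) * (P' x - unitStep x))
      = -((∫ x, (D.m * (Q' x - Q x) + D.n * (P' x - P x)) ^ 2)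
            + D.c * D.m ^ 2 * ∫ x, (Q' x - Q x) ^ 2) := by
    have i1 := ExpDecay.integrable_mul hδ dA dD
    have i2 := (ExpDecay.integrable_mul hδ hQ.expDecay dQ).const_mul (D.c * D.m ^ 2)
    have i3 := (ExpDecay.integrable_mul hδ dE hQ'.expDecay).const_mul (2 * D.m)
    have i4 := (ExpDecay.integrable_mul hδ dD hP'.expDecay).const_mul D.n
    have i5 := ExpDecay.integrable_mul hδ dD dD
    have i6 := (ExpDecay.integrable_mul hδ dQ dQ).const_mul (D.c * D.m ^ 2)
    simp only [pow_two (D.m * (Q' _ - Q _) + D.n * (P' _ - P _)), pow_two (Q' _ - Q _)]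
    simp only [← integral_const_mul]
    have i12 : Integrable fun x => (D.m * (Q x - unitStep x) + D.n * (P x - unitStep x))
        * (D.m * (Q' x - Q x) + D.n * (P' x - P x))
        + D.c * D.m ^ 2 * ((Q x - unitStep x) * (Q' x - Q x)) := i1.add i2
    have i123 : Integrable fun x => (D.m * (Q x - unitStep x) + D.n * (P x - unitStep x))
        * (D.m * (Q' x - Q x) + D.n * (P' x - P x))
        + D.c * D.m ^ 2 * ((Q x - unitStep x) * (Q' x - Q x))
        - 2 * D.m * ((D.m * (1 + D.c) / 2 * (Q' x - Q x) + D.n / 2 * (P' x - P x))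
          * (Q' x - unitStep x)) := i12.sub i3
    rw [← integral_add i1 i2, ← integral_sub i12 i3, ← integral_sub i123 i4,
      ← integral_add i5 i6, ← integral_neg]
    congr 1
    ext x
    ring
  -- Adding 1 to MV keeps M positive while ensuring ε·MV ≤ 1 for the second-order bound.
  refine ⟨MV + 1, by linarith,
    (∫ x, (D.m * (Q' x - Q x) + D.n * (P' x - P x)) ^ 2) / 2
      + D.c * D.m ^ 2 / 2 * (∫ x, (Q' x - Q x) ^ 2) + 2 * D.m * MV ^ 2, fun ε hε hε1 => ?_⟩
  have hbU : ∀ x, |ε * (D.potU P' Q' x - D.potU P Q x)| ≤ ε * MU := fun x => by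
    rw [abs_mul, abs_of_nonneg hε]
    exact mul_le_mul_of_nonneg_left (hMU x) hε
  have hbV : ∀ x, |ε * (D.potV P' Q' x - D.potV P Q x)| ≤ ε * MV := fun x => by
    rw [abs_mul, abs_of_nonneg hε]
    exact mul_le_mul_of_nonneg_left (hMV x) hε
  -- The log-partition function of `potU` enters with a minus sign, so Jensen gives the upper bound
  -- with no remainder; that of `potV` costs (ε·MV)².
  have hlogU := hcU.le_log_integral_exp_add hδ
    (σ := fun x => ε * (D.potU P' Q' x - D.potU P Q x)) (continuous_const.mul hηc) hbU
  have hlogV := hcV.log_integral_exp_add_le hδ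
    (σ := fun x => ε * (D.potV P' Q' x - D.potV P Q x)) (continuous_const.mul hσc) hbV (by linarith)
  simp only [mul_assoc ε, integral_const_mul] at hlogU hlogV
  rw [hU] at hlogU
  rw [hV] at hlogV
  have hsq1 := ExpDecay.integral_add_mul_sq hδ dA dD ε
  have hsq2 := ExpDecay.integral_add_mul_sq hδ hQ.expDecay dQ ε
  have e1 : ∀ x, D.m * (Q x + ε * (Q' x - Q x) - unitStep x)
      + D.n * (P x + ε * (P' x - P x) - unitStep x)
      = D.m * (Q x - unitStep x) + D.n * (P x - unitStep x)
        + ε * (D.m * (Q' x - Q x) + D.n * (P' x - P x)) := fun x => by ring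
  have e2 : ∀ x, Q x + ε * (Q' x - Q x) - unitStep x
      = Q x - unitStep x + ε * (Q' x - Q x) := fun x => by ring
  simp only [energy, potU_convex_comb hP hQ hP' hQ', potV_convex_comb hP hQ hP' hQ', e1]
  simp only [e2]
  rw [hsq1, hsq2]
  have hlogU' := mul_le_mul_of_nonneg_left hlogU D.n_pos.le
  have hlogV' := mul_le_mul_of_nonneg_left hlogV (mul_pos two_pos D.m_pos).le
  have hfirst' := congrArg (ε * ·) hfirst
  linarith

/-! ### Existence of a Gibbs fixed point -/

/-- The Gibbs map has a fixed point. -/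
theorem exists_gibbs_fixed_point (D : WallParams) : ∃ P Q, D.AdmU P ∧ D.AdmV Q ∧
    gibbsCdf (D.potU P Q) = P ∧ gibbsCdf (D.potV P Q) = Q := by
  have hδ := D.δ_pos
  obtain ⟨P, Q, hP, hQ, hmin⟩ := D.exists_energy_min
  refine ⟨P, Q, hP, hQ, ?_⟩
  obtain ⟨P', hP'eq⟩ : ∃ P', P' = gibbsCdf (D.potU P Q) := ⟨_, rfl⟩
  obtain ⟨Q', hQ'eq⟩ : ∃ Q', Q' = gibbsCdf (D.potV P Q) := ⟨_, rfl⟩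
  have hP' : D.AdmU P' := hP'eq ▸ admU_gibbsCdf hP hQ
  have hQ' : D.AdmV Q' := hQ'eq ▸ admV_gibbsCdf hP hQ
  obtain ⟨M, hM, B, hB⟩ := exists_energy_convex_comb_le hP hQ hP'eq hQ'eq
  rw [← hP'eq, ← hQ'eq]
  have dQ := hQ.expDecay_sub hQ'
  have dD := (dQ.const_mul D.m).add ((hP.expDecay_sub hP').const_mul D.n)
  have iQ := ExpDecay.integrable_mul hδ dQ dQ
  have iD := ExpDecay.integrable_mul hδ dD dD
  simp only [← pow_two] at iQ iD
  have n1 : 0 ≤ ∫ x, (Q' x - Q x) ^ 2 := integral_nonneg fun x => sq_nonneg _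
  have n2 : 0 ≤ ∫ x, (D.m * (Q' x - Q x) + D.n * (P' x - P x)) ^ 2 :=
    integral_nonneg fun x => sq_nonneg _
  have hcm : 0 < D.c * D.m ^ 2 := mul_pos D.c_pos (pow_pos D.m_pos 2)
  have hle : (∫ x, (D.m * (Q' x - Q x) + D.n * (P' x - P x)) ^ 2)
      + D.c * D.m ^ 2 * (∫ x, (Q' x - Q x) ^ 2) ≤ 0 := by
    set E := (∫ x, (D.m * (Q' x - Q x) + D.n * (P' x - P x)) ^ 2)
      + D.c * D.m ^ 2 * (∫ x, (Q' x - Q x) ^ 2)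
    -- Minimality gives 0 ≤ -εE + ε²B; divide by ε and let ε tend to 0.
    have hev : ∀ᶠ ε : ℝ in 𝓝[>] 0, E ≤ ε * B := by
      have hsmall : ∀ᶠ ε : ℝ in 𝓝[>] 0, ε < min 1 (1 / M) :=
        
        nhdsWithin_le_nhds (Iio_mem_nhds (lt_min one_pos (one_div_pos.2 hM)))
      filter_upwards [hsmall, self_mem_nhdsWithin] with ε hε hε0
      have hε0' : 0 < ε := hε0
      have h1 : ε ≤ 1 := hε.le.trans (min_le_left _ _)
      have h2 : ε * M ≤ 1 := (le_div_iff₀ hM).1 (hε.le.trans (min_le_right _ _))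
      have h3 := hmin _ _ (hP.convex_comb hP' hε0'.le h1) (hQ.convex_comb hQ' hε0'.le h1)
      have h4 := h3.trans (hB ε hε0'.le h2)
      have h5 : ε * E ≤ ε * (ε * B) := by linarith
      exact le_of_mul_le_mul_left h5 hε0'
    have hlim : Tendsto (fun ε : ℝ => ε * B) (𝓝[>] 0) (𝓝 (0 * B)) :=
      (tendsto_id.mul_const B).mono_left nhdsWithin_le_nhds
    rw [zero_mul] at hlim
    exact ge_of_tendsto hlim hev
  have z1 : ∫ x, (Q' x - Q x) ^ 2 = 0 := by nlinarith
  have z2 : ∫ x, (D.m * (Q' x - Q x) + D.n * (P' x - P x)) ^ 2 = 0 := by nlinarith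
  have cQ : Continuous fun x => Q' x - Q x := hQ'.continuous.sub hQ.continuous
  have cP : Continuous fun x => P' x - P x := hP'.continuous.sub hP.continuous
  -- Since c m² > 0 the second square forces Q' = Q, and then n ≠ 0 lets the first force P' = P.
  have v1 := eq_zero_of_integral_sq_eq_zero cQ iQ z1
  have v2 : ∀ x, D.m * (Q' x - Q x) + D.n * (P' x - P x) = 0 := eq_zero_of_integral_sq_eq_zero
    ((continuous_const.mul cQ).add (continuous_const.mul cP)) iD z2
  refine ⟨funext fun x => ?_, funext fun x => by linarith [v1 x]⟩
  have h := v2 x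
  rw [v1 x, mul_zero, zero_add] at h
  linarith [(mul_eq_zero.1 h).resolve_left D.n_pos.ne']

end WallParams

/-! ### Back to the wall equations -/

/-- Second-order equations for `log w` and `log φ` yield both wall systems. -/
theorem isWall_of_log_equations {g φ₀ θ : ℝ} (hg : 0 < g) (hs : Real.sin θ ≠ 0)
    (hc : Real.cos θ ≠ 0) {A B A' B' : ℝ → ℝ} (hA : ∀ x, HasDerivAt A (A' x) x)
    (hB : ∀ x, HasDerivAt B (B' x) x)
    (hA' : ∀ x, HasDerivAt A' (-(g ^ 2 / 2) * Real.exp (B x) ^ 2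
      - 2 * g ^ 2 * Real.exp (A x) ^ 2) x)
    (hB' : ∀ x, HasDerivAt B' (g ^ 2 / (4 * Real.cos θ ^ 2) * (Real.exp (B x) ^ 2 - φ₀ ^ 2)
      + g ^ 2 * Real.exp (A x) ^ 2) x) :
    (∃ P Z, IsElectroweakWall g φ₀ θ (fun x => Real.exp (A x)) (fun x => Real.exp (B x)) P Z) ∧
      IsSecondOrderWall g φ₀ θ (fun x => Real.exp (A x)) (fun x => Real.exp (B x)) := by
  have dA : deriv A = A' := funext fun x => (hA x).deriv
  have dB : deriv B = B' := funext fun x => (hB x).deriv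
  -- Z is solved from the φ equation, then P from the w equation.
  refine ⟨⟨fun x => -(A' x / g + Real.cos θ * (2 * Real.cos θ / g * B' x)) / Real.sin θ,
    fun x => 2 * Real.cos θ / g * B' x, ?_⟩, ?_⟩
  · refine ⟨fun x => ?_, fun x => ?_, fun x => ?_, fun x => ?_⟩
    · refine (hA x).exp.congr_deriv ?_
      field_simp
      ring
    · refine (hB x).exp.congr_deriv ?_
      field_simp
    -- In P' the φ² terms cancel, and 1 - cos²θ = sin²θ gives the coefficient of w².
    · refine ((((hA' x).div_const g).add
        (((hB' x).const_mul (2 * Real.cos θ / g)).const_mul (Real.cos θ))).neg.div_const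
          (Real.sin θ)).congr_deriv ?_
      field_simp
      rw [Real.sin_sq]
      ring
    · refine ((hB' x).const_mul (2 * Real.cos θ / g)).congr_deriv ?_
      field_simp
      ring
  · refine ⟨fun x => Real.exp_pos _, fun x => Real.exp_pos _, ?_, ?_, ?_, ?_⟩ <;>
      simp only [Real.log_exp]
    · exact fun x => (hA x).differentiableAt
    · exact fun x => (hB x).differentiableAt
    · exact fun x => dA ▸ hA' x
    · exact fun x => dB ▸ hB' x

/-! ### Asymptotics of the potentials -/

theorem IsConfining.tendsto_cocompact {K δ A : ℝ} {f : ℝ → ℝ} (hf : IsConfining K δ A f)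
    (hδ : 0 < δ) : Tendsto f (cocompact ℝ) atBot := by
  refine tendsto_atBot_mono (fun x => ?_) (tendsto_atBot_add_const_left (cocompact ℝ) K
    ((tendsto_norm_cocompact_atTop (E := ℝ)).const_mul_atTop_of_neg (neg_lt_zero.2 hδ)))
  have := hf.le_tent x
  rw [Real.norm_eq_abs]
  linarith

theorem isTheta_const_mul_exp {l : Filter ℝ} {f h : ℝ → ℝ} {k M : ℝ} (hk : k ≠ 0)
    (hM : ∀ᶠ x in l, |f x - h x| ≤ M) :
    (fun x => k * Real.exp (f x)) =Θ[l] fun x => Real.exp (h x) :=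
  (isTheta_const_mul_left hk).2 (Real.isTheta_exp_comp_exp_comp.2 ⟨M, by simpa using hM⟩)

namespace WallParams

variable {D : WallParams} {P Q : ℝ → ℝ}

/-- A two-sided O(1) error in the exponent is what makes the decay rates sharp after exponentiating.
-/
theorem exists_abs_potU_sub_asymptote_le (hP : D.AdmU P) (hQ : D.AdmV Q) : ∃ M, ∀ x,
    |D.potU P Q x - (D.β * x - (D.m + D.n) * max x 0)| ≤ M := by
  refine ⟨(D.m * (D.lipV / D.δ / D.δ) + D.n * (D.lipU / D.δ / D.δ)) * 1, fun x => ?_⟩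
  have := D.abs_lin_le (E := 1) ((hQ.abs_primitive_sub_le D.δ_pos x).trans_eq (mul_one _).symm)
    ((hP.abs_primitive_sub_le D.δ_pos x).trans_eq (mul_one _).symm)
  rw [← abs_neg] at this
  convert this using 2
  simp only [potU]
  ring

theorem exists_abs_potV_sub_asymptote_le (hP : D.AdmU P) (hQ : D.AdmV Q) : ∃ M, ∀ x,
    |D.potV P Q x - (-D.s * x - D.κ * x ^ 2 + (D.m * (1 + D.c) + D.n) / 2 * max x 0)| ≤ M := by
  refine ⟨(D.m * ((1 + D.c) / 2 * (D.lipV / D.δ / D.δ))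
    + D.n * (1 / 2 * (D.lipU / D.δ / D.δ))) * 1, fun x => ?_⟩
  have hc : 0 ≤ (1 + D.c) / 2 := by linarith [D.c_pos]
  have h1 : |(1 + D.c) / 2 * ((∫ y in (0 : ℝ)..x, Q y) - max x 0)|
      ≤ (1 + D.c) / 2 * (D.lipV / D.δ / D.δ) * 1 := by
    rw [abs_mul, abs_of_nonneg hc, mul_one]
    exact mul_le_mul_of_nonneg_left (hQ.abs_primitive_sub_le D.δ_pos x) hc
  have h2 : |1 / 2 * ((∫ y in (0 : ℝ)..x, P y) - max x 0)|
      ≤ 1 / 2 * (D.lipU / D.δ / D.δ) * 1 := by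
    rw [abs_mul, abs_of_nonneg (by norm_num), mul_one]
    exact mul_le_mul_of_nonneg_left (hP.abs_primitive_sub_le D.δ_pos x) (by norm_num)
  convert D.abs_lin_le h1 h2 using 2
  simp only [potV]
  ring

end WallParams

/-! ### The domain wall theorem -/

theorem theorem6p1 (g φ₀ θ α₁ β₁ α₂ β₂ : ℝ)
    (hg : 0 < g) (hφ₀ : 0 < φ₀) (hθ₀ : 0 < θ) (hθ : θ < Real.pi / 2)
    (hα₂ : α₂ < 0) (hβ₂ : β₂ < 0)
    (h₁ : 0 < α₁ + β₁)
    (h₂ : (α₁ + β₁) / Real.tan θ ^ 2 < |α₂| + |β₂|)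
    (h₃ : |α₂| + |β₂| < min |α₂| |β₂| + (α₁ + β₁) / Real.tan θ ^ 2) :
    ∃ w φ P Z : ℝ → ℝ,
      IsElectroweakWall g φ₀ θ w φ P Z ∧
      IsSecondOrderWall g φ₀ θ w φ ∧
      (Tendsto w atTop (𝓝 0) ∧ Tendsto w atBot (𝓝 0) ∧
        Tendsto φ atTop (𝓝 0) ∧ Tendsto φ atBot (𝓝 0)) ∧
      ((fun x => w x ^ 2) =Θ[atTop] fun x => Real.exp (-|α₂| * x)) ∧
      ((fun x => w x ^ 2) =Θ[atBot] fun x => Real.exp (|β₂| * x)) ∧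
      ((fun x => φ x ^ 2) =Θ[atTop] fun x =>
        Real.exp (-(g ^ 2 * φ₀ ^ 2 / (4 * Real.cos θ ^ 2)) * x ^ 2
          + 1 / 2 * (α₁ + |α₂|) * x)) ∧
      ((fun x => φ x ^ 2) =Θ[atBot] fun x =>
        Real.exp (-(g ^ 2 * φ₀ ^ 2 / (4 * Real.cos θ ^ 2)) * x ^ 2
          - 1 / 2 * (β₁ + |β₂|) * x)) ∧
      (Integrable (fun x => w x ^ 2) ∧
        ∫ x, w x ^ 2 =
          1 / (4 * g ^ 2) * (|α₂| + |β₂| - (α₁ + β₁) / Real.tan θ ^ 2)) ∧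
      (Integrable (fun x => φ x ^ 2) ∧
        ∫ x, φ x ^ 2 = (α₁ + β₁) / (g ^ 2 * Real.tan θ ^ 2)) := by
  have hsin : 0 < Real.sin θ := Real.sin_pos_of_pos_of_lt_pi hθ₀ (by linarith [Real.pi_pos])
  have hcos : 0 < Real.cos θ := Real.cos_pos_of_mem_Ioo ⟨by linarith, hθ⟩
  have htan : 0 < Real.tan θ := Real.tan_pos_of_pos_of_lt_pi_div_two hθ₀ hθ
  have hcm : (α₁ + β₁) / Real.tan θ ^ 2 * Real.tan θ ^ 2 = α₁ + β₁ := by field_simp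
  have h1c : 1 + Real.tan θ ^ 2 = 1 / Real.cos θ ^ 2 := by
    rw [Real.tan_eq_sin_div_cos]
    field_simp
    linarith [Real.sin_sq_add_cos_sq θ]
  -- Subtracting min from both sides, the third hypothesis says exactly that m exceeds max(|α₂|,
  -- |β₂|), the confinement condition.
  have hmA : |α₂| < (α₁ + β₁) / Real.tan θ ^ 2 := by linarith [min_le_right |α₂| |β₂|]
  have hmB : |β₂| < (α₁ + β₁) / Real.tan θ ^ 2 := by linarith [min_le_left |α₂| |β₂|]
  obtain ⟨m, hm⟩ : ∃ m, m = (α₁ + β₁) / Real.tan θ ^ 2 := ⟨_, rfl⟩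
  have hm0 : 0 < m := hm ▸ div_pos h₁ (pow_pos htan 2)
  have hφint : (α₁ + β₁) / (g ^ 2 * Real.tan θ ^ 2) = m / g ^ 2 := by
    rw [hm, div_div, mul_comm]
  rw [hφint]
  rw [← hm] at h₂ hcm hmA hmB ⊢
  obtain ⟨n, hn⟩ : ∃ n, n = |α₂| + |β₂| - m := ⟨_, rfl⟩
  have hn0 : 0 < n := by linarith
  rw [← hn]
  -- κ and c come from the coefficients of (ln φ²)'' by 1/cos²θ = 1 + tan²θ. The drift s is minus
  -- the linear coefficient prescribed for ln φ² at -∞; the one at +∞ then follows from the masses.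
  let D : WallParams :=
    { α := |α₂|, β := |β₂|, m := m, n := n
      κ := g ^ 2 * φ₀ ^ 2 / (4 * Real.cos θ ^ 2)
      c := Real.tan θ ^ 2, s := (β₁ + |β₂|) / 2
      δ := min (m - |α₂|) (m - |β₂|)
      β_pos := abs_pos.2 hβ₂.ne, m_pos := hm0, n_pos := hn0
      κ_pos := by positivity
      c_pos := by positivity
      δ_pos := lt_min (by linarith) (by linarith)
      balance := by linarith
      δ_le_α := min_le_left _ _
      δ_le_β := min_le_right _ _ }
  obtain ⟨P, Q, hP, hQ, hPfix, hQfix⟩ := D.exists_gibbs_fixed_point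
  have hδ := D.δ_pos
  have hU := WallParams.isConfining_potU hP hQ
  have hV := WallParams.isConfining_potV (D := D) hP hQ
  have hP' := hU.hasDerivAt_gibbsCdf hδ
  have hQ' := hV.hasDerivAt_gibbsCdf hδ
  rw [hPfix] at hP'
  rw [hQfix] at hQ'
  have hdU : ∀ x, HasDerivAt (D.potU P Q) (|β₂| - (m * Q x + n * P x)) x :=
    fun x => WallParams.hasDerivAt_potU hP hQ x
  have hdV : ∀ x, HasDerivAt (D.potV P Q) (-((β₁ + |β₂|) / 2)
      - 2 * (g ^ 2 * φ₀ ^ 2 / (4 * Real.cos θ ^ 2)) * x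
      + (m * (1 + Real.tan θ ^ 2) * Q x + n * P x) / 2) x :=
    fun x => WallParams.hasDerivAt_potV hP hQ x
  obtain ⟨MU, hMU⟩ := WallParams.exists_abs_potU_sub_asymptote_le hP hQ
  have hasyU : ∀ x, |D.potU P Q x - (|β₂| * x - (m + n) * max x 0)| ≤ MU := hMU
  obtain ⟨MV, hMV⟩ := WallParams.exists_abs_potV_sub_asymptote_le hP hQ
  have hasyV : ∀ x, |D.potV P Q x - (-((β₁ + |β₂|) / 2) * x
      - (g ^ 2 * φ₀ ^ 2 / (4 * Real.cos θ ^ 2)) * x ^ 2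
      + (m * (1 + Real.tan θ ^ 2) + n) / 2 * max x 0)| ≤ MV := hMV
  have hintU := hU.integrable_exp hδ
  have hintV := hV.integrable_exp hδ
  have hZU := hU.integral_pos hδ
  have hZV := hV.integral_pos hδ
  have hlimU := hU.tendsto_cocompact hδ
  have hlimV := hV.tendsto_cocompact hδ
  generalize D.potU P Q = u at *
  generalize D.potV P Q = v at *
  set ZU := ∫ x, Real.exp (u x)
  set ZV := ∫ x, Real.exp (v x)
  -- The constants a and b normalise w² and φ² to total masses n/(4g²) and m/g².
  obtain ⟨a, ha⟩ : ∃ a, a = n / (4 * g ^ 2) / ZU := ⟨_, rfl⟩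
  obtain ⟨b, hb⟩ : ∃ b, b = m / g ^ 2 / ZV := ⟨_, rfl⟩
  have ha0 : 0 < a := by rw [ha]; positivity
  have hb0 : 0 < b := by rw [hb]; positivity
  have hw2 : ∀ x, Real.exp (u x / 2 + Real.log a / 2) ^ 2 = a * Real.exp (u x) := fun x => by
    rw [← Real.exp_nat_mul, mul_comm a, ← Real.exp_log ha0, ← Real.exp_add, Real.log_exp]
    congr 1
    push_cast
    ring
  have hφ2 : ∀ x, Real.exp (v x / 2 + Real.log b / 2) ^ 2 = b * Real.exp (v x) := fun x => by
    rw [← Real.exp_nat_mul, mul_comm b, ← Real.exp_log hb0, ← Real.exp_add, Real.log_exp]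
    congr 1
    push_cast
    ring
  obtain ⟨⟨P₁, Z₁, hwall⟩, hsecond⟩ := isWall_of_log_equations (g := g) (φ₀ := φ₀) (θ := θ) hg
    hsin.ne' hcos.ne'
    (A := fun x => u x / 2 + Real.log a / 2) (B := fun x => v x / 2 + Real.log b / 2)
    (fun x => ((hdU x).div_const 2).add_const _) (fun x => ((hdV x).div_const 2).add_const _)
    (fun x => by
      refine (((((hQ' x).const_mul m).add ((hP' x).const_mul n)).const_sub |β₂|).div_const
        2).congr_deriv ?_
      rw [hw2, hφ2, ha, hb]
      field_simp
      ring)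
    (fun x => by
      refine ((((hasDerivAt_id x).const_mul
        (2 * (g ^ 2 * φ₀ ^ 2 / (4 * Real.cos θ ^ 2)))).const_sub (-((β₁ + |β₂|) / 2))).add
        ((((hQ' x).const_mul (m * (1 + Real.tan θ ^ 2))).add
          ((hP' x).const_mul n)).div_const 2)).div_const 2 |>.congr_deriv ?_
      rw [hw2, hφ2, ha, hb, h1c]
      field_simp
      ring)
  have hlim : ∀ {f : ℝ → ℝ} (k : ℝ), Tendsto f (cocompact ℝ) atBot →
      Tendsto (fun x => Real.exp (f x / 2 + k)) (atBot ⊔ atTop) (𝓝 0) := fun {f} k hf => by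
    rw [← cocompact_eq_atBot_atTop]
    exact Real.tendsto_exp_atBot.comp
      (tendsto_atBot_add_const_right _ _ (hf.atBot_div_const two_pos))
  have hlw := tendsto_sup.1 (hlim (Real.log a / 2) hlimU)
  have hlφ := tendsto_sup.1 (hlim (Real.log b / 2) hlimV)
  refine ⟨_, _, P₁, Z₁, hwall, hsecond, ⟨hlw.2, hlw.1, hlφ.2, hlφ.1⟩, ?_⟩
  simp only [hw2, hφ2]
  refine ⟨isTheta_const_mul_exp (M := MU) ha0.ne' ?_,
    isTheta_const_mul_exp (M := MU) ha0.ne' ?_, isTheta_const_mul_exp (M := MV) hb0.ne' ?_,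
    isTheta_const_mul_exp (M := MV) hb0.ne' ?_, ⟨hintU.const_mul a, ?_⟩, hintV.const_mul b, ?_⟩
  · filter_upwards [eventually_ge_atTop 0] with x hx
    convert hasyU x using 3
    rw [max_eq_left hx, hn]
    ring
  · filter_upwards [eventually_le_atBot 0] with x hx
    convert hasyU x using 3
    rw [max_eq_right hx]
    ring
  · filter_upwards [eventually_ge_atTop 0] with x hx
    convert hasyV x using 3
    rw [max_eq_left hx, hn]
    -- The slope -s + (m(1 + tan²θ) + n)/2 equals (α₁ + |α₂|)/2 because m tan²θ = α₁ + β₁.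
    linear_combination (-x / 2) * hcm
  · filter_upwards [eventually_le_atBot 0] with x hx
    convert hasyV x using 3
    rw [max_eq_right hx]
    ring
  · rw [integral_const_mul, ha, div_mul_cancel₀ _ hZU.ne']
    ring
  · rw [integral_const_mul, hb, div_mul_cancel₀ _ hZV.ne']
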